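/- A partition $\lambda=(\lambda_1\ge\lambda_2\ge\dots\ge\lambda_\ell>0)$ of $n=|\lambda|=\sum_i\lambda_i$ has multiplicities $m_r(\lambda)=|\{i:\lambda_i=r\}|$ and the statistic $n(\lambda)=\sum_i(i-1)\lambda_i$. Put $\phi_m(t)=(1-t)(1-t^2)\cdots(1-t^m)$ and $b_\lambda(t)=\prod_{r\ge1}\phi_{m_r(\lambda)}(t)$. For partitions $\lambda,\mu$ of the same $n$, write $\lambda\le\mu$ (dominance order) if $\lambda_1+\dots+\lambda_i\le\mu_1+\dots+\mu_i$ for all $i$, and $\lambda<\mu$ if moreover $\lambda\ne\mu$. For a field $k$ let $M_\lambda=\bigoplus_i k[T]/(T^{\lambda_i})$. For $k$ finite let $F_{\lambda\mu}^{\xi}(k)$ be the number of $k[T]$-submodules $U\subseteq M_\xi$ with $U\cong M_\mu$ and $M_\xi/U\cong M_\lambda$. The Hall polynomial $F_{\lambda\mu}^{\xi}\in\mathbb Z[T]$ is the unique polynomial with $F_{\lambda\mu}^{\xi}(|k|)=F_{\lambda\mu}^{\xi}(k)$ for every finite field $k$. The generic Ringel–Hall algebra $H_1$ is the $\mathbb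 Q(v)$-vector space with basis $(u_\lambda)$ indexed by all partitions, with the bilinear multiplication $$u_\lambda u_\mu=\sum_{\xi}F_{\lambda\mu}^{\xi}(v^2)\,u_\xi$$ (a finite sum, since $F_{\lambda\mu}^{\xi}=0$ unless $|\xi|=|\lambda|+|\mu|$) and unit $u_\varnothing$. Put $q=v^2$, $x_r=(1-q^{-1})u_{(r)}$ for $r\ge1$, and $x_\lambda=\prod_i x_{\lambda_i}$. **Proposition.** The Hall polynomials $F_{\lambda\mu}^{\xi}$ exist for all partitions $\lambda,\mu,\xi$, and $H_1$ is a commutative, associative, unital $\mathbb Q(v)$-algebra. For every $n\ge0$ and every partition $\lambda$ of $n$ there are $\gamma_{\lambda\mu}\in\mathbb Q(v)$ such that $$x_\lambda=q^{n(\lambda)}\,b_\lambda(q^{-1})\,u_\lambda+\sum_{\mu>\lambda}\gamma_{\lambda\mu}\,u_\mu ,$$ where $\mu$ runs over the partitions of $n$ that are strictly greater than $\lambda$ in the dominance order. Consequently the $x_\lambda$, for all partitions $\lambda$, form a basis of $H_1$ over $\mathbb Q(v)$; and the $x_r$ ($r\ge1$) are algebraically independent over $\mathbb Q(v)$ and generate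 $H_1$ as a $\mathbb Q(v)$-algebra. -/

import Mathlib

open scoped Polynomial

/-- Partitions of arbitrary size: a pair of a natural number `n` and a partition of `n`. -/
abbrev Ptn : Type := Σ n : ℕ, n.Partition

namespace Ptn

/-- The size `|lam|`. -/
def size (lam : Ptn) : ℕ := lam.1

/-- The multiset of (positive) parts. -/
def parts (lam : Ptn) : Multiset ℕ := lam.2.parts

/-- The parts in weakly decreasing order. -/
def rows (lam : Ptn) : List ℕ := lam.parts.sort (fun a b => b ≤ a)

/-- The `i`-th part, counted from `i = 0`, and `0` beyond the length. -/
def row (lam : Ptn) (i : ℕ) : ℕ := lam.rows.getD i 0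

/-- The empty partition, of size `0`. -/
def empty : Ptn := ⟨0, Nat.Partition.indiscrete 0⟩

/-- For `r ≥ 1`, the partition `(r)` with the single part `r`. -/
def single (r : ℕ) : Ptn := ⟨r, Nat.Partition.indiscrete r⟩

/-- `n(lam) = ∑ (i - 1) lam_i`, where the parts are counted from `i = 1`; here from `i = 0`. -/
def nStat (lam : Ptn) : ℕ := ∑ i ∈ Finset.range lam.rows.length, i * lam.row i

/-- The multiplicity `m_r(lam)` of `r` as a part. -/
def mult (lam : Ptn) (r : ℕ) : ℕ := lam.parts.count r

end Ptn

/-- The strict dominance order on the partitions of `n`. -/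
def DominanceLT {n : ℕ} (lam mu : n.Partition) : Prop :=
  (∀ i : ℕ, ∑ j ∈ Finset.range i, Ptn.row ⟨n, lam⟩ j ≤ ∑ j ∈ Finset.range i, Ptn.row ⟨n, mu⟩ j) ∧
    lam ≠ mu

open Classical in
/-- The partitions `mu` of `n` with `mu > lam` in the dominance order. -/
noncomputable def strictlyAbove {n : ℕ} (lam : n.Partition) : Finset n.Partition :=
  Finset.univ.filter fun mu => DominanceLT lam mu

/-- `φ_n(t) = (1 - t)(1 - t²) ⋯ (1 - tⁿ)`. -/
def phiProd {R : Type*} [CommRing R] (n : ℕ) (t : R) : R :=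
  ∏ i ∈ Finset.range n, (1 - t ^ (i + 1))

/-- `b_lam(t) = ∏_r φ_{m_r(lam)}(t)`; the product is over the `r` with `m_r(lam) ≠ 0`,
and the other factors are `1`. -/
def bProd {R : Type*} [CommRing R] (lam : Ptn) (t : R) : R :=
  ∏ r ∈ lam.parts.toFinset, phiProd (lam.mult r) t

/-- The nilpotent `k[T]`-module `M_lam = ⨁_i k[T] / (T ^ lam_i)`. The index type is that of the
parts of `lam`, with multiplicity; it is finite, so the product is the direct sum. -/
abbrev NilpModule (k : Type) [Field k] (lam : Ptn) : Type :=
  (i : lam.parts.ToType) → k[X] ⧸ Ideal.span {(Polynomial.X : k[X]) ^ (i.1 : ℕ)}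

/-- The Hall number `F_{lam mu}^{xi}` over the (finite) field `k`: the number of submodules `U` of
`M_xi` with `U ≅ M_mu` and `M_xi / U ≅ M_lam`. -/
noncomputable def hallNumber (k : Type) [Field k] (lam mu xi : Ptn) : ℕ :=
  Nat.card {U : Submodule k[X] (NilpModule k xi) //
    Nonempty (U ≃ₗ[k[X]] NilpModule k mu) ∧
      Nonempty ((NilpModule k xi ⧸ U) ≃ₗ[k[X]] NilpModule k lam)}

/-- `P` gives the Hall numbers of type `(lam, mu, xi)` over all finite fields. At most one integer
polynomial does, since there are infinitely many finite cardinalities `|k|`. -/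
def IsHallPolynomial (lam mu xi : Ptn) (P : ℤ[X]) : Prop :=
  ∀ (k : Type) [Field k] [Finite k], P.eval (Nat.card k : ℤ) = (hallNumber k lam mu xi : ℤ)

open Classical in
/-- The Hall polynomial `F_{lam mu}^{xi}(T)`. -/
noncomputable def hallPolynomial (lam mu xi : Ptn) : ℤ[X] :=
  if h : ∃ P : ℤ[X], IsHallPolynomial lam mu xi P then h.choose else 0

/-- The indeterminate `v` of `ℚ(v)`. -/
noncomputable def vGen : RatFunc ℚ := RatFunc.X

/-- `q = v²`. -/
noncomputable def qGen : RatFunc ℚ := vGen ^ 2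

/-- The underlying vector space of the generic Ringel-Hall algebra over `ℚ(v)`: the free vector
space on the set of partitions. (Not reducible, so that it does not inherit the pointwise
multiplication of finitely supported functions.) -/
def HallAlg : Type := Ptn →₀ RatFunc ℚ

namespace HallAlg

noncomputable instance : AddCommGroup HallAlg := inferInstanceAs (AddCommGroup (Ptn →₀ RatFunc ℚ))

noncomputable instance : Module (RatFunc ℚ) HallAlg :=
  inferInstanceAs (Module (RatFunc ℚ) (Ptn →₀ RatFunc ℚ))

/-- The basis `u_lam`, indexed by all partitions. -/
noncomputable def u : Module.Basis Ptn (RatFunc ℚ) HallAlg :=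
  Module.Basis.ofRepr (LinearEquiv.refl (RatFunc ℚ) (Ptn →₀ RatFunc ℚ))

/-- The bilinear multiplication with `u_lam u_mu = ∑_xi F_{lam mu}^{xi}(v²) u_xi`. The sum is over
the `xi` with `|xi| = |lam| + |mu|`, because all other Hall numbers are zero. -/
noncomputable def hallMul : HallAlg →ₗ[RatFunc ℚ] HallAlg →ₗ[RatFunc ℚ] HallAlg :=
  u.constr (RatFunc ℚ) fun lam => u.constr (RatFunc ℚ) fun mu =>
    ∑ xi : (lam.size + mu.size).Partition,
      Polynomial.aeval qGen (hallPolynomial lam mu ⟨_, xi⟩) • u ⟨_, xi⟩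

noncomputable instance : Mul HallAlg := ⟨fun a b => hallMul a b⟩

/-- The unit is `u_∅`. -/
noncomputable instance : One HallAlg := ⟨u Ptn.empty⟩

/-- The ring structure given by the Hall multiplication, once the ring axioms are known that do not
follow from bilinearity. -/
@[reducible] noncomputable def commRing
    (hone : ∀ a : HallAlg, 1 * a = a)
    (hcomm : ∀ a b : HallAlg, a * b = b * a)
    (hassoc : ∀ a b c : HallAlg, a * b * c = a * (b * c)) : CommRing HallAlg :=
  { (inferInstance : AddCommGroup HallAlg) with
    mul := fun a b => a * b
    one := 1
    one_mul := hone
    mul_one := fun a => (hcomm a 1).trans (hone a)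
    mul_comm := hcomm
    mul_assoc := hassoc
    left_distrib := fun a b c => map_add (hallMul a) b c
    right_distrib := fun a b c => LinearMap.map_add₂ hallMul a b c
    zero_mul := fun a => LinearMap.map_zero₂ hallMul a
    mul_zero := fun a => map_zero (hallMul a) }

/-- The `ℚ(v)`-algebra structure; its scalar multiplication is that of the vector space. -/
@[reducible] noncomputable def algebra
    (hone : ∀ a : HallAlg, 1 * a = a)
    (hcomm : ∀ a b : HallAlg, a * b = b * a)
    (hassoc : ∀ a b c : HallAlg, a * b * c = a * (b * c)) :
    letI := commRing hone hcomm hassoc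
    Algebra (RatFunc ℚ) HallAlg :=
  letI := commRing hone hcomm hassoc
  Algebra.ofModule
    (fun c a b => LinearMap.map_smul₂ hallMul c a b)
    (fun c a b => map_smul (hallMul a) c b)

/-- `x_r = (1 - q⁻¹) u_{(r)}`, for `r ≥ 1`. -/
noncomputable def x (r : ℕ) : HallAlg := (1 - qGen⁻¹) • u (Ptn.single r)

end HallAlg

/-! The isomorphism type of a finite `T`-nilpotent module `N` is determined by the sizes of the
submodules `T ^ i N`. For `M_lam` the exponent of `|k|` is `lam.rk i`, and the second differences of
`rk` are the multiplicities of `lam`. Isomorphism questions thus become counting questions.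

For `U ≤ N`, `T ^ i U ≤ T ^ i N ⊓ U` gives `lam.rk i + mu.rk i ≤ xi.rk i` whenever a Hall number is
nonzero (`rk_add_le`). Hence every `xi` occurring in `u_lam u_(r)` lies above `Ptn.cons r hr lam` in
the rank order, which implies dominance (`Ptn.sum_row_le_of_rk_le`). This is the source of all
triangularity.

Associativity counts flags `U ≤ V` in two ways (`hallCount_assoc`). Commutativity comes from a
nondegenerate form on `M_xi` for which `T` is self-adjoint: `U ↦ perp U` exchanges type and cotype
(`hallNumber_comm`).

For `mu = (r)`, Hall numbers count cyclic submodules, hence generators up to a factor `q ^ r - q ^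
(r - 1)`. Being a suitable generator depends only on the levels of the coordinates, and each level
is attained by a polynomial number of elements. General Hall numbers follow by associativity,
solving for the lowest term of `u_mu u_(r)`. The divisions that occur have monic denominators and
integer values, so they give integer polynomials (`IsPolyCount.of_mul_eval`).

Multiplying out `x_lam` with the smallest part last, the coefficient of `u_lam` gains a factor that
is computed exactly (`HallAlg.structConst_cons`). It is nonzero, so the `x_lam` form a basis. Since
they are precisely the monomials in the `x_r`, algebraic independence and generation are
restatements of this. -/

namespace Ptn

/-! ### Partitions: ranks, dominance and energy -/

theorem ext_parts {lam mu : Ptn} (h : lam.parts = mu.parts) : lam = mu := by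
  obtain ⟨n, lam⟩ := lam
  obtain ⟨m, mu⟩ := mu
  have h' : lam.parts = mu.parts := h
  have hnm : n = m := by rw [← lam.parts_sum, h', mu.parts_sum]
  subst hnm
  congr 1
  exact Nat.Partition.ext h'

theorem pos_of_mem {lam : Ptn} {p : ℕ} (h : p ∈ lam.parts) : 0 < p := lam.2.parts_pos h

theorem sum_parts (lam : Ptn) : lam.parts.sum = lam.size := lam.2.parts_sum

/-- The partition with a given multiset of positive parts. -/
def ofParts (s : Multiset ℕ) (h : ∀ p ∈ s, 0 < p) : Ptn := ⟨s.sum, ⟨s, fun hp => h _ hp, rfl⟩⟩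

@[simp] theorem parts_ofParts (s : Multiset ℕ) (h : ∀ p ∈ s, 0 < p) : (ofParts s h).parts = s := rfl

/-- The partition obtained by adding a part `r`. -/
def cons (r : ℕ) (hr : 0 < r) (lam : Ptn) : Ptn :=
  ofParts (r ::ₘ lam.parts) fun p hp => by
    rcases Multiset.mem_cons.1 hp with rfl | hp
    · exact hr
    · exact pos_of_mem hp

@[simp] theorem parts_cons (r : ℕ) (hr : 0 < r) (lam : Ptn) :
    (cons r hr lam).parts = r ::ₘ lam.parts := rfl

@[simp] theorem size_cons (r : ℕ) (hr : 0 < r) (lam : Ptn) :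
    (cons r hr lam).size = r + lam.size := by
  rw [← sum_parts, ← sum_parts, parts_cons, Multiset.sum_cons]

@[simp] theorem parts_empty : empty.parts = 0 := by
  simp [empty, parts]

@[simp] theorem size_empty : empty.size = 0 := rfl

@[simp] theorem parts_single {r : ℕ} (hr : 0 < r) : (single r).parts = {r} :=
  Nat.Partition.indiscrete_parts hr.ne'

@[simp] theorem size_single (r : ℕ) : (single r).size = r := rfl

/-- Splitting off the smallest part appends it at the end of `rows`, so the positions of the other
parts in `nStat` do not move. -/
theorem induction_min {P : Ptn → Prop} (h0 : P empty)
    (h1 : ∀ r (hr : 0 < r) lam, (∀ p ∈ lam.parts, r ≤ p) → P lam → P (cons r hr lam))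
    (lam : Ptn) : P lam := by
  induction hn : lam.size using Nat.strong_induction_on generalizing lam with
  | _ n ih =>
    by_cases hz : lam.parts = 0
    · rwa [ext_parts (hz.trans parts_empty.symm)]
    · obtain ⟨a, ha⟩ := Multiset.exists_mem_of_ne_zero hz
      have hne : lam.parts.toFinset.Nonempty := ⟨a, by simpa using ha⟩
      obtain ⟨r, hr, hmin⟩ := lam.parts.toFinset.exists_min_image id hne
      simp only [Multiset.mem_toFinset, id] at hr hmin
      have hr0 := pos_of_mem hr
      let mu : Ptn := ofParts (lam.parts.erase r) fun p hp => pos_of_mem (Multiset.mem_of_mem_erase hp)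
      have hlam : lam = cons r hr0 mu := ext_parts (by
        rw [parts_cons, parts_ofParts, Multiset.cons_erase hr])
      rw [hlam]
      refine h1 r hr0 mu (fun p hp => hmin p (Multiset.mem_of_mem_erase hp)) (ih mu.size ?_ mu rfl)
      rw [← hn, hlam, size_cons]
      omega

/-- `∑_p max (p - i, 0)`, the sum over the parts `p`; this is the dimension of `T ^ i M_lam`. -/
def rk (lam : Ptn) (i : ℕ) : ℕ := (lam.parts.map fun p => p - i).sum

theorem rk_zero (lam : Ptn) : lam.rk 0 = lam.size := by
  simp [rk, sum_parts]

@[simp] theorem rk_cons (r : ℕ) (hr : 0 < r) (lam : Ptn) (i : ℕ) :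
    (cons r hr lam).rk i = (r - i) + lam.rk i := by
  simp [rk]

@[simp] theorem rk_single {r : ℕ} (hr : 0 < r) (i : ℕ) : (single r).rk i = r - i := by
  simp [rk, hr]

theorem rk_le_size (lam : Ptn) (i : ℕ) : lam.rk i ≤ lam.size := by
  rw [← rk_zero]
  exact Multiset.sum_map_le_sum_map _ _ fun p _ => by omega

theorem rk_eq_zero (lam : Ptn) {i : ℕ} (h : lam.size ≤ i) : lam.rk i = 0 := by
  rw [rk, Multiset.sum_eq_zero]
  intro x hx
  obtain ⟨p, hp, rfl⟩ := Multiset.mem_map.1 hx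
  have := Multiset.le_sum_of_mem hp
  rw [sum_parts] at this
  omega

theorem rk_eq_rk_succ_add (lam : Ptn) (i : ℕ) :
    lam.rk i = lam.rk (i + 1) + lam.parts.countP (i < ·) := by
  unfold rk
  induction lam.parts using Multiset.induction_on with
  | empty => simp
  | cons a s ih =>
    rw [Multiset.map_cons, Multiset.map_cons, Multiset.sum_cons, Multiset.sum_cons,
      Multiset.countP_cons, ih]
    split_ifs <;> omega

theorem countP_lt_eq (s : Multiset ℕ) (i : ℕ) :
    s.countP (i < ·) = s.countP (i + 1 < ·) + s.count (i + 1) := by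
  induction s using Multiset.induction_on with
  | empty => simp
  | cons a s ih =>
    rw [Multiset.countP_cons, Multiset.countP_cons, Multiset.count_cons, ih]
    split_ifs <;> omega

/-- The first difference of `rk` at `i` counts the parts exceeding `i`, so the second difference is
the multiplicity of `i + 1`. -/
theorem rk_injective {lam mu : Ptn} (h : ∀ i, lam.rk i = mu.rk i) : lam = mu := by
  apply ext_parts
  ext p
  obtain _ | p := p
  · rw [Multiset.count_eq_zero_of_notMem fun h0 => (pos_of_mem h0).ne' rfl,
      Multiset.count_eq_zero_of_notMem fun h0 => (pos_of_mem h0).ne' rfl]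
  · have h1 := countP_lt_eq lam.parts p
    have h2 := countP_lt_eq mu.parts p
    have h3 := lam.rk_eq_rk_succ_add p
    have h4 := mu.rk_eq_rk_succ_add p
    have h5 := lam.rk_eq_rk_succ_add (p + 1)
    have h6 := mu.rk_eq_rk_succ_add (p + 1)
    rw [h, h] at h3 h5
    omega

theorem coe_rows (lam : Ptn) : (lam.rows : Multiset ℕ) = lam.parts := Multiset.sort_eq _ _

theorem rows_pairwise (lam : Ptn) : lam.rows.Pairwise (fun a b => b ≤ a) :=
  Multiset.pairwise_sort _ _

theorem row_antitone (lam : Ptn) : Antitone lam.row := by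
  intro i j hij
  by_cases hj : j < lam.rows.length
  · have hi : i < lam.rows.length := by omega
    rw [row, row, List.getD_eq_getElem _ _ hj, List.getD_eq_getElem _ _ hi]
    rcases hij.lt_or_eq with h | rfl
    · exact List.pairwise_iff_getElem.1 lam.rows_pairwise i j hi hj h
    · rfl
  · rw [row, row, List.getD_eq_default _ _ (by omega)]
    exact Nat.zero_le _

theorem rk_eq_sum_row (lam : Ptn) (i : ℕ) {m : ℕ} (hm : lam.rows.length ≤ m) :
    lam.rk i = ∑ j ∈ Finset.range m, (lam.row j - i) := by
  rw [rk, ← coe_rows, Multiset.map_coe, Multiset.sum_coe,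
    ← Finset.sum_subset (Finset.range_mono hm)]
  · rw [← Fin.sum_univ_eq_sum_range (fun j => lam.row j - i), ← List.sum_ofFn]
    congr 1
    apply List.ext_getElem <;> simp [row]
  · intro j _ hj
    have hj' : lam.rows.length ≤ j := by simpa using hj
    rw [row, List.getD_eq_default _ _ hj', Nat.zero_sub]

/-- For every `i`, the first `k` rows sum to at most `rk i + k * i`. Equality holds when `i`
separates the first `k` rows from the others. -/
theorem sum_row_le_of_rk_le {lam mu : Ptn} (h : ∀ i, lam.rk i ≤ mu.rk i) (k : ℕ) :
    ∑ j ∈ Finset.range k, lam.row j ≤ ∑ j ∈ Finset.range k, mu.row j := by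
  set m := max k (max lam.rows.length mu.rows.length)
  -- Rows are counted from `0`, so this is the first row of `mu` not in the sum; it makes the bound
  -- sharp for `mu`.
  set i := mu.row k with hi
  have hkm : Finset.range k ⊆ Finset.range m := Finset.range_mono (by omega)
  have h1 : ∑ j ∈ Finset.range k, lam.row j ≤ lam.rk i + k * i := by
    rw [lam.rk_eq_sum_row i (m := m) (by omega)]
    calc ∑ j ∈ Finset.range k, lam.row j
        ≤ ∑ j ∈ Finset.range k, ((lam.row j - i) + i) :=
          Finset.sum_le_sum fun j _ => by omega
      _ = ∑ j ∈ Finset.range k, (lam.row j - i) + k * i := by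
          rw [Finset.sum_add_distrib]; simp
      _ ≤ _ := by gcongr
  have h2 : mu.rk i + k * i = ∑ j ∈ Finset.range k, mu.row j := by
    rw [mu.rk_eq_sum_row i (m := m) (by omega), ← Finset.sum_subset hkm]
    · rw [← smul_eq_mul, ← Finset.card_range k, ← Finset.sum_const, Finset.card_range,
        ← Finset.sum_add_distrib]
      refine Finset.sum_congr rfl fun j hj => ?_
      have := mu.row_antitone (Finset.mem_range.1 hj).le
      omega
    · intro j _ hj
      have := mu.row_antitone (show k ≤ j by simpa using hj)
      omega
  calc _ ≤ _ := h1
    _ ≤ mu.rk i + k * i := by gcongr; exact h i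
    _ = _ := h2

/-- The sum of the ranks, a strictly monotone function for the order given by the ranks. -/
def energy (lam : Ptn) : ℕ := ∑ i ∈ Finset.range lam.size, lam.rk i

theorem energy_le (lam : Ptn) : lam.energy ≤ lam.size * lam.size := by
  refine (Finset.sum_le_card_nsmul _ _ lam.size fun i _ => lam.rk_le_size i).trans ?_
  simp

theorem energy_lt {lam mu : Ptn} (hs : lam.size = mu.size) (h : ∀ i, lam.rk i ≤ mu.rk i)
    (hne : lam ≠ mu) : lam.energy < mu.energy := by
  rw [energy, energy, ← hs]
  apply Finset.sum_lt_sum (fun i _ => h i)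
  by_contra hcon
  push Not at hcon
  refine hne (rk_injective fun i => ?_)
  by_cases hi : i < lam.size
  · exact le_antisymm (h i) (hcon i (Finset.mem_range.2 hi))
  · rw [lam.rk_eq_zero (by omega), mu.rk_eq_zero (by omega)]

theorem rows_cons {r : ℕ} (hr : 0 < r) {lam : Ptn} (hmin : ∀ p ∈ lam.parts, r ≤ p) :
    (cons r hr lam).rows = lam.rows ++ [r] := by
  refine List.Perm.eq_of_pairwise' (r := fun a b => b ≤ a) (rows_pairwise _) ?_ ?_
  · rw [List.pairwise_append]
    refine ⟨rows_pairwise _, List.pairwise_singleton _ _, fun a ha b hb => ?_⟩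
    rw [List.mem_singleton.1 hb]
    exact hmin a (by rwa [← coe_rows])
  · rw [← Multiset.coe_eq_coe, coe_rows, parts_cons, ← Multiset.coe_add, coe_rows, add_comm]
    rfl

theorem nStat_cons {r : ℕ} (hr : 0 < r) {lam : Ptn} (hmin : ∀ p ∈ lam.parts, r ≤ p) :
    (cons r hr lam).nStat = lam.nStat + Multiset.card lam.parts * r := by
  have hl : lam.rows.length = Multiset.card lam.parts := Multiset.length_sort _
  rw [nStat, nStat, rows_cons hr hmin, List.length_append, List.length_singleton,
    Finset.sum_range_succ, hl]
  congr 1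
  · refine Finset.sum_congr rfl fun i hi => ?_
    rw [row, row, rows_cons hr hmin, List.getD_append _ _ _ _ (by rw [hl]; simpa using hi)]
  · rw [row, rows_cons hr hmin, List.getD_append_right _ _ _ _ (by omega), hl]
    simp

@[simp] theorem nStat_empty : empty.nStat = 0 := by
  simp [nStat, rows]

theorem mult_cons (r : ℕ) (hr : 0 < r) (lam : Ptn) : (cons r hr lam).mult r = lam.mult r + 1 := by
  simp [mult]

end Ptn

@[simp] theorem bProd_empty {R : Type*} [CommRing R] (t : R) : bProd Ptn.empty t = 1 := by
  simp [bProd]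

theorem bProd_cons {R : Type*} [CommRing R] (r : ℕ) (hr : 0 < r) (lam : Ptn) (t : R) :
    bProd (Ptn.cons r hr lam) t = bProd lam t * (1 - t ^ (lam.mult r + 1)) := by
  -- Parts of multiplicity `0` contribute `1`, so both products can be taken over one common index
  -- set.
  have key : ∀ (mu : Ptn) (S : Finset ℕ), mu.parts.toFinset ⊆ S →
      bProd mu t = ∏ p ∈ S, phiProd (mu.mult p) t := by
    intro mu S hS
    refine Finset.prod_subset hS fun p _ hp => ?_
    rw [Ptn.mult, Multiset.count_eq_zero_of_notMem (by simpa using hp)]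
    simp [phiProd]
  set S := insert r lam.parts.toFinset with hS
  rw [key _ S (by simp [hS]), key lam S (by simp [hS]),
    ← Finset.mul_prod_erase S _ (Finset.mem_insert_self r _),
    ← Finset.mul_prod_erase S _ (Finset.mem_insert_self r _), Ptn.mult_cons, phiProd,
    Finset.prod_range_succ, ← phiProd]
  have : ∏ p ∈ S.erase r, phiProd ((Ptn.cons r hr lam).mult p) t =
      ∏ p ∈ S.erase r, phiProd (lam.mult p) t := by
    refine Finset.prod_congr rfl fun p hp => ?_
    rw [Ptn.mult, Ptn.parts_cons, Multiset.count_cons_of_ne (Finset.ne_of_mem_erase hp), ← Ptn.mult]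
  rw [this]
  ring

/-! ### Functions of a finite field that are polynomial in its order -/

/-- An integer attached to every finite field is given by an integer polynomial in `|k|`. -/
def IsPolyCount (f : (k : Type) → [Field k] → [Finite k] → ℤ) : Prop :=
  ∃ P : ℤ[X], ∀ (k : Type) [Field k] [Finite k], P.eval (Nat.card k : ℤ) = f k

namespace IsPolyCount

variable {f g : (k : Type) → [Field k] → [Finite k] → ℤ}

theorem const (c : ℤ) : IsPolyCount fun _ _ _ => c := ⟨Polynomial.C c, fun _ _ _ => by simp⟩

theorem card_pow (n : ℕ) : IsPolyCount fun k _ _ => (Nat.card k : ℤ) ^ n :=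
  ⟨Polynomial.X ^ n, fun _ _ _ => by simp⟩

theorem add (hf : IsPolyCount f) (hg : IsPolyCount g) : IsPolyCount fun k _ _ => f k + g k := by
  obtain ⟨P, hP⟩ := hf
  obtain ⟨Q, hQ⟩ := hg
  exact ⟨P + Q, fun k _ _ => by rw [Polynomial.eval_add, hP, hQ]⟩

theorem sub (hf : IsPolyCount f) (hg : IsPolyCount g) : IsPolyCount fun k _ _ => f k - g k := by
  obtain ⟨P, hP⟩ := hf
  obtain ⟨Q, hQ⟩ := hg
  exact ⟨P - Q, fun k _ _ => by rw [Polynomial.eval_sub, hP, hQ]⟩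

theorem mul (hf : IsPolyCount f) (hg : IsPolyCount g) : IsPolyCount fun k _ _ => f k * g k := by
  obtain ⟨P, hP⟩ := hf
  obtain ⟨Q, hQ⟩ := hg
  exact ⟨P * Q, fun k _ _ => by rw [Polynomial.eval_mul, hP, hQ]⟩

theorem sum {ι : Type*} (s : Finset ι) {F : ι → (k : Type) → [Field k] → [Finite k] → ℤ}
    (h : ∀ i ∈ s, IsPolyCount (F i)) : IsPolyCount fun k _ _ => ∑ i ∈ s, F i k := by
  choose! P hP using h
  exact ⟨∑ i ∈ s, P i, fun k _ _ => by
    rw [Polynomial.eval_finsetSum]; exact Finset.sum_congr rfl fun i hi => hP i hi k⟩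

theorem prod {ι : Type*} (s : Finset ι) {F : ι → (k : Type) → [Field k] → [Finite k] → ℤ}
    (h : ∀ i ∈ s, IsPolyCount (F i)) : IsPolyCount fun k _ _ => ∏ i ∈ s, F i k := by
  choose! P hP using h
  exact ⟨∏ i ∈ s, P i, fun k _ _ => by
    rw [Polynomial.eval_prod]; exact Finset.prod_congr rfl fun i hi => hP i hi k⟩

end IsPolyCount

/-- Two integer polynomials with the same values at the orders of the finite fields are equal. -/
theorem polynomial_ext_of_eval_card {P Q : ℤ[X]}
    (h : ∀ (k : Type) [Field k] [Finite k],
      P.eval (Nat.card k : ℤ) = Q.eval (Nat.card k : ℤ)) : P = Q := by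
  refine Polynomial.eq_of_infinite_eval_eq P Q ?_
  refine (Nat.infinite_setOfPred_prime.image (f := fun n : ℕ => (n : ℤ))
    (Nat.cast_injective.injOn)).mono ?_
  rintro _ ⟨p, hp, rfl⟩
  have : Fact p.Prime := ⟨hp⟩
  simpa using h (ZMod p)

open Filter Topology in
/-- An integer-valued quotient of integer polynomials with monic denominator is a polynomial. -/
theorem IsPolyCount.of_mul_eval {f : (k : Type) → [Field k] → [Finite k] → ℤ} {C : ℤ[X]}
    (hC : C.Monic) (hC0 : ∀ (k : Type) [Field k] [Finite k], C.eval (Nat.card k : ℤ) ≠ 0)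
    (h : IsPolyCount fun k _ _ => f k * C.eval (Nat.card k : ℤ)) : IsPolyCount f := by
  obtain ⟨A, hA⟩ := h
  have hdiv := Polynomial.modByMonic_add_div A C
  have hR : ∀ (k : Type) [Field k] [Finite k], (A %ₘ C).eval (Nat.card k : ℤ) =
      (f k - (A /ₘ C).eval (Nat.card k : ℤ)) * C.eval (Nat.card k : ℤ) := by
    intro k _ _
    have := hA k
    rw [← hdiv, Polynomial.eval_add, Polynomial.eval_mul] at this
    linear_combination this
  -- At a large prime the remainder divided by `C` has absolute value below `1`, yet by `hR` it is
  -- an integer. So the remainder vanishes at infinitely many primes.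
  have hR0 : A %ₘ C = 0 := by
    have hinj : Function.Injective (Int.castRingHom ℝ) := Int.cast_injective
    have hlim := Polynomial.div_tendsto_atTop_zero_of_degree_lt
      ((A %ₘ C).map (Int.castRingHom ℝ)) (C.map (Int.castRingHom ℝ)) (by
        rw [Polynomial.degree_map_eq_of_injective hinj, Polynomial.degree_map_eq_of_injective hinj]
        exact Polynomial.degree_modByMonic_lt A hC)
    obtain ⟨N, hN⟩ := (((tendsto_natCast_atTop_atTop (R := ℝ)).eventually
      (hlim.eventually (Metric.ball_mem_nhds (0 : ℝ) one_pos)))).exists_forall_of_atTop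
    refine Polynomial.eq_zero_of_infinite_isRoot _ ?_
    refine (Nat.infinite_setOfPred_prime.sdiff (Set.finite_lt_nat N)).image (f := fun n : ℕ => (n : ℤ))
      (Nat.cast_injective.injOn) |>.mono ?_
    rintro _ ⟨p, ⟨hp, hpN⟩, rfl⟩
    have : Fact p.Prime := ⟨hp⟩
    have h1 := hN p (by simpa using hpN)
    have h2 := hR (ZMod p)
    have h3 := hC0 (ZMod p)
    rw [Nat.card_zmod] at h2 h3
    simp only [Polynomial.eval_map, Polynomial.eval₂_at_natCast] at h1
    have h4 : |(((A %ₘ C).eval (p : ℤ) : ℤ) : ℝ) / ((C.eval (p : ℤ) : ℤ) : ℝ)| < 1 := by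
      rw [abs_div]; simpa using h1
    rw [h2, Int.cast_mul, mul_div_cancel_right₀ _ (by exact_mod_cast h3)] at h4
    have h5 : f (ZMod p) - (A /ₘ C).eval (p : ℤ) = 0 := by
      rw [← Int.abs_lt_one_iff]
      exact_mod_cast h4
    change (A %ₘ C).eval (p : ℤ) = 0
    rw [h2, h5, zero_mul]
  refine ⟨A /ₘ C, fun k _ _ => ?_⟩
  have := hR k
  rw [hR0, Polynomial.eval_zero, eq_comm, mul_eq_zero, or_iff_left (hC0 k)] at this
  linarith

/-! ### The submodules `T ^ i N` and their orders -/

/-- The cyclic module `k[T] / (T ^ n)`. -/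
abbrev CyclicModule (k : Type) [Field k] (n : ℕ) : Type :=
  k[X] ⧸ Ideal.span {(Polynomial.X : k[X]) ^ n}

section powRange

variable (k : Type) [Field k] (N : Type*) [AddCommGroup N] [Module k[X] N]

/-- The submodule `T ^ i N`. -/
noncomputable def powRange (i : ℕ) : Submodule k[X] N :=
  LinearMap.range (LinearMap.lsmul k[X] N (Polynomial.X ^ i))

variable {k N}

theorem mem_powRange {i : ℕ} {x : N} :
    x ∈ powRange k N i ↔ ∃ y : N, (Polynomial.X ^ i : k[X]) • y = x := by
  simp [powRange]

theorem pow_smul_mem_powRange (i : ℕ) (x : N) : (Polynomial.X ^ i : k[X]) • x ∈ powRange k N i :=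
  mem_powRange.2 ⟨x, rfl⟩

theorem powRange_antitone : Antitone (powRange k N) := by
  intro i j hij x hx
  obtain ⟨y, rfl⟩ := mem_powRange.1 hx
  obtain ⟨d, rfl⟩ := Nat.exists_eq_add_of_le hij
  rw [pow_add, mul_smul]
  exact pow_smul_mem_powRange _ _

@[simp] theorem powRange_zero : powRange k N 0 = ⊤ :=
  eq_top_iff.2 fun x _ => mem_powRange.2 ⟨x, by simp⟩

theorem map_powRange {N' : Type*} [AddCommGroup N'] [Module k[X] N'] (f : N →ₗ[k[X]] N')
    (hf : Function.Surjective f) (i : ℕ) : (powRange k N i).map f = powRange k N' i := by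
  ext y
  rw [Submodule.mem_map, mem_powRange]
  constructor
  · rintro ⟨x, hx, rfl⟩
    obtain ⟨z, rfl⟩ := mem_powRange.1 hx
    exact ⟨f z, by rw [map_smul]⟩
  · rintro ⟨z, rfl⟩
    obtain ⟨z, rfl⟩ := hf z
    exact ⟨_, pow_smul_mem_powRange i z, by rw [map_smul]⟩

theorem card_powRange_congr {N' : Type*} [AddCommGroup N'] [Module k[X] N'] (e : N ≃ₗ[k[X]] N')
    (i : ℕ) : Nat.card (powRange k N i) = Nat.card (powRange k N' i) := by
  rw [← map_powRange (e : N →ₗ[k[X]] N') e.surjective]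
  exact Nat.card_congr (e.submoduleMap (powRange k N i)).toEquiv

theorem mem_powRange_pi {ι : Type*} {A : ι → Type*} [∀ j, AddCommGroup (A j)]
    [∀ j, Module k[X] (A j)] {i : ℕ} {x : ∀ j, A j} :
    x ∈ powRange k (∀ j, A j) i ↔ ∀ j, x j ∈ powRange k (A j) i := by
  simp only [mem_powRange]
  constructor
  · rintro ⟨y, rfl⟩ j
    exact ⟨y j, rfl⟩
  · intro h
    choose y hy using h
    exact ⟨y, funext hy⟩

end powRange

section finite

variable (k : Type) [Field k]

theorem mk_mem_powRange_iff {n c : ℕ} {f : k[X]} :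
    (Ideal.Quotient.mk _ f : CyclicModule k n) ∈ powRange k (CyclicModule k n) c ↔
      (Polynomial.X ^ (min c n) : k[X]) ∣ f := by
  rw [mem_powRange]
  constructor
  · rintro ⟨y, hy⟩
    obtain ⟨g, rfl⟩ := Ideal.Quotient.mk_surjective y
    have h2 : (Ideal.Quotient.mk (Ideal.span {(Polynomial.X : k[X]) ^ n})) (Polynomial.X ^ c * g) =
        Ideal.Quotient.mk _ f := hy
    rw [Ideal.Quotient.eq, Ideal.mem_span_singleton] at h2
    have h3 : (Polynomial.X ^ (min c n) : k[X]) ∣ Polynomial.X ^ c * g :=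
      (pow_dvd_pow _ (min_le_left _ _)).mul_right _
    exact (dvd_sub_right h3).1 ((pow_dvd_pow _ (min_le_right _ _)).trans h2)
  · intro h
    rcases le_total c n with hcn | hcn
    · rw [min_eq_left hcn] at h
      obtain ⟨g, rfl⟩ := h
      exact ⟨Ideal.Quotient.mk _ g, rfl⟩
    · rw [min_eq_right hcn] at h
      refine ⟨0, ?_⟩
      rw [smul_zero, eq_comm, Ideal.Quotient.eq_zero_iff_mem, Ideal.mem_span_singleton]
      exact h

/-- On representatives this is cancellation of `T ^ a` in a divisibility; the truncated subtraction
covers the case where it holds automatically. -/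
theorem pow_smul_mem_powRange_iff {n a i : ℕ} {y : CyclicModule k n} :
    (Polynomial.X ^ a : k[X]) • y ∈ powRange k (CyclicModule k n) i ↔
      y ∈ powRange k (CyclicModule k n) (min i n - a) := by
  obtain ⟨f, rfl⟩ := Ideal.Quotient.mk_surjective y
  change (Ideal.Quotient.mk _ (Polynomial.X ^ a * f) : CyclicModule k n) ∈ _ ↔ _
  rw [mk_mem_powRange_iff, mk_mem_powRange_iff]
  rw [show min (min i n - a) n = min i n - a by omega]
  rcases le_total (min i n) a with h | h
  · rw [Nat.sub_eq_zero_of_le h, pow_zero]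
    exact iff_of_true ((pow_dvd_pow _ h).mul_right _) (one_dvd _)
  · obtain ⟨d, hd⟩ := Nat.exists_eq_add_of_le h
    rw [hd, Nat.add_sub_cancel_left, pow_add,
      mul_dvd_mul_iff_left (pow_ne_zero _ Polynomial.X_ne_zero)]

theorem eq_zero_iff_mem_powRange {n i : ℕ} (h : n ≤ i) {y : CyclicModule k n} :
    y ∈ powRange k (CyclicModule k n) i ↔ y = 0 := by
  obtain ⟨f, rfl⟩ := Ideal.Quotient.mk_surjective y
  rw [mk_mem_powRange_iff, min_eq_right h, Ideal.Quotient.eq_zero_iff_mem,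
    Ideal.mem_span_singleton]

theorem natCard_cyclicModule (n : ℕ) : Nat.card (CyclicModule k n) = Nat.card k ^ n := by
  have hm : ((Polynomial.X : k[X]) ^ n).Monic := Polynomial.monic_X_pow n
  have : Module.Finite k (CyclicModule k n) := hm.finite_quotient
  rw [Module.natCard_eq_pow_finrank (K := k), finrank_quotient_span_eq_natDegree,
    Polynomial.natDegree_X_pow]

instance [Finite k] (n : ℕ) : Finite (CyclicModule k n) :=
  Nat.finite_of_card_ne_zero (by
    rw [natCard_cyclicModule]; exact pow_ne_zero _ Nat.card_pos.ne')

theorem card_powRange_cyclicModule (n c : ℕ) :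
    Nat.card (powRange k (CyclicModule k n) c) = Nat.card k ^ (n - c) := by
  let f : k[X] →ₗ[k[X]] CyclicModule k n :=
    (LinearMap.lsmul k[X] (CyclicModule k n) (Polynomial.X ^ c)).comp (Submodule.mkQ _)
  have hr : LinearMap.range f = powRange k (CyclicModule k n) c :=
    LinearMap.range_comp_of_range_eq_top _ (Submodule.range_mkQ _)
  have hk : LinearMap.ker f = Ideal.span {(Polynomial.X : k[X]) ^ (n - c)} := by
    ext g
    rw [LinearMap.mem_ker, Ideal.mem_span_singleton]
    change (Ideal.Quotient.mk _ (Polynomial.X ^ c * g) : CyclicModule k n) = 0 ↔ _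
    rw [Ideal.Quotient.eq_zero_iff_mem, Ideal.mem_span_singleton]
    rcases le_total n c with h | h
    · rw [Nat.sub_eq_zero_of_le h, pow_zero]
      exact iff_of_true ((pow_dvd_pow _ h).mul_right _) (one_dvd _)
    · obtain ⟨d, rfl⟩ := Nat.exists_eq_add_of_le h
      rw [Nat.add_sub_cancel_left, pow_add,
        mul_dvd_mul_iff_left (pow_ne_zero _ Polynomial.X_ne_zero)]
  rw [← natCard_cyclicModule k, ← hr, ← Nat.card_congr f.quotKerEquivRange.toEquiv]
  exact Nat.card_congr (Submodule.quotEquivOfEq _ _ hk).toEquiv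

instance [Finite k] (lam : Ptn) : Finite (NilpModule k lam) := Pi.finite

theorem card_pi_powRange (lam : Ptn) (c : lam.parts.ToType → ℕ) :
    Nat.card {x : NilpModule k lam // ∀ j, x j ∈ powRange k (CyclicModule k j.1) (c j)} =
      Nat.card k ^ ∑ j, ((j.1 : ℕ) - c j) := by
  rw [Nat.card_congr (Equiv.subtypePiEquivPi (p := fun (j : lam.parts.ToType)
    (y : CyclicModule k j.1) => y ∈ powRange k (CyclicModule k j.1) (c j))), Nat.card_pi,
    ← Finset.prod_pow_eq_pow_sum]
  exact Finset.prod_congr rfl fun j _ => card_powRange_cyclicModule k _ _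

theorem sum_toType (s : Multiset ℕ) (f : ℕ → ℕ) : ∑ j : s.ToType, f j.1 = (s.map f).sum := by
  conv_rhs => rw [← Multiset.map_univ_coe s, Multiset.map_map]
  rfl

theorem card_powRange_nilpModule (lam : Ptn) (i : ℕ) :
    Nat.card (powRange k (NilpModule k lam) i) = Nat.card k ^ lam.rk i := by
  rw [Ptn.rk, ← sum_toType, ← card_pi_powRange k lam fun _ => i]
  exact Nat.card_congr (Equiv.subtypeEquivRight fun x => mem_powRange_pi)

theorem natCard_nilpModule (lam : Ptn) : Nat.card (NilpModule k lam) = Nat.card k ^ lam.size := by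
  rw [← Ptn.rk_zero, ← card_powRange_nilpModule, powRange_zero]
  exact (Nat.card_congr Submodule.topEquiv.toEquiv).symm

end finite

/-! ### Classification of finite nilpotent modules -/

section classification

variable (k : Type) [Field k]

/-- A power of `T` annihilates the module. -/
def XNilpotent (N : Type*) [AddCommGroup N] [Module k[X] N] : Prop :=
  ∃ m : ℕ, ∀ x : N, (Polynomial.X ^ m : k[X]) • x = 0

variable {k} in
theorem XNilpotent.submodule {N : Type*} [AddCommGroup N] [Module k[X] N] (h : XNilpotent k N)
    (U : Submodule k[X] N) : XNilpotent k U :=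
  h.imp fun _ hm x => Subtype.ext (hm x)

variable {k} in
theorem XNilpotent.quotient {N : Type*} [AddCommGroup N] [Module k[X] N] (h : XNilpotent k N)
    (U : Submodule k[X] N) : XNilpotent k (N ⧸ U) := by
  obtain ⟨m, hm⟩ := h
  refine ⟨m, fun x => ?_⟩
  obtain ⟨x, rfl⟩ := U.mkQ_surjective x
  rw [← map_smul, hm, map_zero]

theorem le_size_of_toType {lam : Ptn} (j : lam.parts.ToType) : j.1 ≤ lam.size := by
  rw [← Ptn.sum_parts]
  exact Multiset.le_sum_of_mem (Multiset.coe_mem)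

theorem pow_size_smul (lam : Ptn) (x : NilpModule k lam) :
    (Polynomial.X ^ lam.size : k[X]) • x = 0 := by
  funext j
  exact (eq_zero_iff_mem_powRange k (le_size_of_toType j)).1 (pow_smul_mem_powRange _ (x j))

theorem xNilpotent_nilpModule (lam : Ptn) : XNilpotent k (NilpModule k lam) :=
  ⟨lam.size, pow_size_smul k lam⟩

theorem card_fiber_eq_count {ι : Type*} [Fintype ι] (g : ι → ℕ) (c : ℕ) :
    Nat.card {j // g j = c} = (Finset.univ.val.map g).count c := by
  rw [Multiset.count_map, Nat.card_eq_fintype_card, Fintype.card_subtype, Finset.card_def,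
    Finset.filter_val]
  simp only [eq_comm]

theorem exists_equiv_toType {ι : Type*} [Fintype ι] (f : ι → ℕ) {s : Multiset ℕ}
    (h : s = Finset.univ.val.map f) : ∃ σ : s.ToType ≃ ι, ∀ j, f (σ j) = j.1 := by
  have e : ∀ c, Nonempty ({j : s.ToType // j.1 = c} ≃ {i // f i = c}) := fun c => by
    refine ⟨Fintype.equivOfCardEq ?_⟩
    rw [← Nat.card_eq_fintype_card, ← Nat.card_eq_fintype_card,
      card_fiber_eq_count (fun j : s.ToType => j.1), Multiset.map_univ_coe,
      card_fiber_eq_count, h]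
  exact ⟨Equiv.ofFiberEquiv fun c => (e c).some, Equiv.ofFiberEquiv_map _⟩

theorem exists_equiv_nilpModule_of_pi {d : ℕ} (e : Fin d → ℕ) :
    ∃ lam : Ptn, Nonempty (((i : Fin d) → CyclicModule k (e i)) ≃ₗ[k[X]] NilpModule k lam) := by
  -- Exponents `0` give zero modules and must be dropped, since the parts of a partition are
  -- positive.
  have h1 : ∃ f : ((i : Fin d) → CyclicModule k (e i)) ≃ₗ[k[X]]
      ((i : {i // e i ≠ 0}) → CyclicModule k (e i.1)), True := by
    refine ⟨LinearEquiv.ofBijective (LinearMap.pi fun i => LinearMap.proj i.1) ⟨?_, ?_⟩, trivial⟩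
    · intro x y hxy
      funext i
      by_cases hi : e i = 0
      · have : Subsingleton (CyclicModule k (e i)) := by
          rw [hi]
          exact Ideal.Quotient.subsingleton_iff.2 (by simp)
        exact Subsingleton.elim _ _
      · exact congrFun hxy ⟨i, hi⟩
    · intro y
      refine ⟨fun i => if h : e i ≠ 0 then y ⟨i, h⟩ else 0, ?_⟩
      funext i
      exact dif_pos i.2
  obtain ⟨f, -⟩ := h1
  let lam : Ptn := Ptn.ofParts (Finset.univ.val.map fun i : {i // e i ≠ 0} => e i.1) (by
    intro p hp
    obtain ⟨i, -, rfl⟩ := Multiset.mem_map.1 hp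
    exact Nat.pos_of_ne_zero i.2)
  obtain ⟨σ, hσ⟩ := exists_equiv_toType (fun i : {i // e i ≠ 0} => e i.1) (s := lam.parts) rfl
  let g : ((i : {i // e i ≠ 0}) → CyclicModule k (e i.1)) ≃ₗ[k[X]]
      ((j : lam.parts.ToType) → CyclicModule k (e (σ j).1)) :=
    LinearEquiv.piCongrLeft' k[X] (fun i : {i // e i ≠ 0} => CyclicModule k (e i.1)) σ.symm
  let h : ((j : lam.parts.ToType) → CyclicModule k (e (σ j).1)) ≃ₗ[k[X]] NilpModule k lam :=
    LinearEquiv.piCongrRight fun j => Submodule.quotEquivOfEq _ _ (by rw [hσ j])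
  exact ⟨lam, ⟨f ≪≫ₗ g ≪≫ₗ h⟩⟩

theorem exists_equiv_nilpModule (N : Type*) [AddCommGroup N] [Module k[X] N] [Finite N]
    (hN : XNilpotent k N) : ∃ lam : Ptn, Nonempty (N ≃ₗ[k[X]] NilpModule k lam) := by
  have ht : Module.IsTorsion' N (Submonoid.powers (Polynomial.X : k[X])) := by
    obtain ⟨m, hm⟩ := hN
    exact fun {x} => ⟨⟨Polynomial.X ^ m, m, rfl⟩, hm x⟩
  obtain ⟨d, e, ⟨f⟩⟩ := Module.torsion_by_prime_power_decomposition Polynomial.irreducible_X ht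
  obtain ⟨lam, ⟨g⟩⟩ := exists_equiv_nilpModule_of_pi k e
  exact ⟨lam, ⟨f ≪≫ₗ DirectSum.linearEquivFunOnFintype _ _ _ ≪≫ₗ g⟩⟩

variable [Finite k]

theorem one_lt_natCard : 1 < Nat.card k := Finite.one_lt_card

/-- The orders of the `T ^ i N` are a complete invariant: some type exists by the structure theorem,
and ranks determine it. -/
theorem equiv_nilpModule_iff {N : Type*} [AddCommGroup N] [Module k[X] N] [Finite N]
    (hN : XNilpotent k N) {lam : Ptn} : Nonempty (N ≃ₗ[k[X]] NilpModule k lam) ↔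
      ∀ i, Nat.card (powRange k N i) = Nat.card k ^ lam.rk i := by
  constructor
  · rintro ⟨e⟩ i
    rw [card_powRange_congr e, card_powRange_nilpModule]
  · intro h
    obtain ⟨mu, ⟨e⟩⟩ := exists_equiv_nilpModule k N hN
    have : lam = mu := Ptn.rk_injective fun i =>
      Nat.pow_right_injective (one_lt_natCard k) (by
        simp only
        rw [← h, card_powRange_congr e, card_powRange_nilpModule])
    rw [this]
    exact ⟨e⟩

theorem ptn_eq_of_equiv {lam mu : Ptn} (e : NilpModule k lam ≃ₗ[k[X]] NilpModule k mu) :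
    lam = mu :=
  Ptn.rk_injective fun i => Nat.pow_right_injective (one_lt_natCard k) (by
    simp only
    rw [← card_powRange_nilpModule, card_powRange_congr e, card_powRange_nilpModule])

end classification

/-! ### Orders in submodules and quotients, and the rank inequality -/

section card

variable {k : Type} [Field k] {N : Type*} [AddCommGroup N] [Module k[X] N]

theorem card_map_mul_card_inf_ker {N' : Type*} [AddCommGroup N'] [Module k[X] N']
    (f : N →ₗ[k[X]] N') (S : Submodule k[X] N) :
    Nat.card (S.map f) * Nat.card (S ⊓ LinearMap.ker f : Submodule k[X] N) = Nat.card S := by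
  rw [Submodule.card_eq_card_quotient_mul_card (LinearMap.ker (f.domRestrict S)), mul_comm,
    Nat.card_congr (f.domRestrict S).quotKerEquivRange.toEquiv, LinearMap.range_domRestrict]
  congr 1
  have : LinearMap.ker (f.domRestrict S) =
      Submodule.comap S.subtype (S ⊓ LinearMap.ker f) := by
    ext x
    simp
  rw [this]
  exact Nat.card_congr (Submodule.comapSubtypeEquivOfLe inf_le_left).symm.toEquiv

/-- The projection maps `T ^ i N` onto `T ^ i (N ⧸ U)` with kernel `T ^ i N ⊓ U`. -/
theorem card_powRange_quotient_mul (U : Submodule k[X] N) (i : ℕ) :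
    Nat.card (powRange k (N ⧸ U) i) * Nat.card (powRange k N i ⊓ U : Submodule k[X] N) =
      Nat.card (powRange k N i) := by
  rw [← map_powRange U.mkQ U.mkQ_surjective, ← card_map_mul_card_inf_ker U.mkQ (powRange k N i), U.ker_mkQ]

theorem map_subtype_powRange_le (U : Submodule k[X] N) (i : ℕ) :
    (powRange k U i).map U.subtype ≤ powRange k N i ⊓ U := by
  rintro _ ⟨x, hx, rfl⟩
  obtain ⟨y, rfl⟩ := mem_powRange.1 hx
  exact ⟨pow_smul_mem_powRange i (y : N), U.smul_mem _ y.2⟩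

theorem card_powRange_submodule_le [Finite N] (U : Submodule k[X] N) (i : ℕ) :
    Nat.card (powRange k U i) ≤ Nat.card (powRange k N i ⊓ U : Submodule k[X] N) := by
  rw [Nat.card_congr (Submodule.equivMapOfInjective _ U.injective_subtype (powRange k U i)).toEquiv]
  exact Nat.card_le_card_of_injective _ (Submodule.inclusion_injective (map_subtype_powRange_le U i))

end card

section hallNumber

variable {k : Type} [Field k] [Finite k] {lam mu xi : Ptn}

theorem rk_add_le (U : Submodule k[X] (NilpModule k xi))
    (hU : Nonempty (U ≃ₗ[k[X]] NilpModule k mu))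
    (hQ : Nonempty ((NilpModule k xi ⧸ U) ≃ₗ[k[X]] NilpModule k lam)) (i : ℕ) :
    lam.rk i + mu.rk i ≤ xi.rk i := by
  obtain ⟨e⟩ := hU
  obtain ⟨f⟩ := hQ
  have h := card_powRange_quotient_mul U i
  rw [card_powRange_congr f i, card_powRange_nilpModule, card_powRange_nilpModule] at h
  rw [← Nat.pow_le_pow_iff_right (one_lt_natCard k), pow_add, ← h, ← card_powRange_nilpModule k mu,
    ← card_powRange_congr (N := U) e i]
  gcongr
  exact card_powRange_submodule_le U i

theorem size_add_eq (U : Submodule k[X] (NilpModule k xi))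
    (hU : Nonempty (U ≃ₗ[k[X]] NilpModule k mu))
    (hQ : Nonempty ((NilpModule k xi ⧸ U) ≃ₗ[k[X]] NilpModule k lam)) :
    lam.size + mu.size = xi.size := by
  obtain ⟨e⟩ := hU
  obtain ⟨f⟩ := hQ
  refine Nat.pow_right_injective (one_lt_natCard k) ?_
  simp only
  rw [pow_add, ← natCard_nilpModule k, ← natCard_nilpModule k, ← natCard_nilpModule k,
    ← Nat.card_congr e.toEquiv, ← Nat.card_congr f.toEquiv,
    Submodule.card_eq_card_quotient_mul_card U, mul_comm]

omit [Finite k] in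
theorem exists_of_hallNumber_ne_zero (h : hallNumber k lam mu xi ≠ 0) :
    ∃ U : Submodule k[X] (NilpModule k xi), Nonempty (U ≃ₗ[k[X]] NilpModule k mu) ∧
      Nonempty ((NilpModule k xi ⧸ U) ≃ₗ[k[X]] NilpModule k lam) := by
  obtain ⟨⟨U, hU⟩⟩ := (Nat.card_ne_zero.1 h).1
  exact ⟨U, hU⟩

theorem rk_add_le_of_hallNumber_ne_zero (h : hallNumber k lam mu xi ≠ 0) (i : ℕ) :
    lam.rk i + mu.rk i ≤ xi.rk i := by
  obtain ⟨U, hU, hQ⟩ := exists_of_hallNumber_ne_zero h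
  exact rk_add_le U hU hQ i

theorem size_add_of_hallNumber_ne_zero (h : hallNumber k lam mu xi ≠ 0) :
    lam.size + mu.size = xi.size := by
  obtain ⟨U, hU, hQ⟩ := exists_of_hallNumber_ne_zero h
  exact size_add_eq U hU hQ

end hallNumber

/-! ### Associativity of Hall numbers -/

namespace Ptn

/-- The finite set of partitions of `n`. -/
def ofSize (n : ℕ) : Finset Ptn :=
  Finset.univ.map ⟨fun lam : n.Partition => (⟨n, lam⟩ : Ptn), sigma_mk_injective⟩

theorem mem_ofSize {n : ℕ} {lam : Ptn} : lam ∈ ofSize n ↔ lam.size = n := by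
  simp only [ofSize, Finset.mem_map, Finset.mem_univ, true_and, Function.Embedding.coeFn_mk]
  constructor
  · rintro ⟨lam, rfl⟩
    rfl
  · rintro rfl
    exact ⟨lam.2, rfl⟩

theorem sum_ofSize {A : Type*} [AddCommMonoid A] (n : ℕ) (f : Ptn → A) :
    ∑ lam ∈ ofSize n, f lam = ∑ lam : n.Partition, f ⟨n, lam⟩ :=
  Finset.sum_map _ _ _

end Ptn

section hallCount

variable (k : Type) [Field k]

/-- The number of submodules of `N` of type `mu` and cotype `lam`. -/
noncomputable def hallCount (N : Type*) [AddCommGroup N] [Module k[X] N] (lam mu : Ptn) : ℕ :=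
  Nat.card {U : Submodule k[X] N //
    Nonempty (U ≃ₗ[k[X]] NilpModule k mu) ∧ Nonempty ((N ⧸ U) ≃ₗ[k[X]] NilpModule k lam)}

variable {k}

theorem nonempty_equiv_congr {A B C : Type*} [AddCommMonoid A] [AddCommMonoid B]
    [AddCommMonoid C] [Module k[X] A] [Module k[X] B] [Module k[X] C] (e : A ≃ₗ[k[X]] B) :
    Nonempty (A ≃ₗ[k[X]] C) ↔ Nonempty (B ≃ₗ[k[X]] C) :=
  ⟨fun ⟨f⟩ => ⟨e.symm.trans f⟩, fun ⟨f⟩ => ⟨e.trans f⟩⟩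

variable {N : Type*} [AddCommGroup N] [Module k[X] N]

theorem hallCount_congr {N' : Type*} [AddCommGroup N'] [Module k[X] N'] (e : N ≃ₗ[k[X]] N')
    (lam mu : Ptn) : hallCount k N lam mu = hallCount k N' lam mu := by
  refine Nat.card_congr ((Submodule.orderIsoMapComap e).toEquiv.subtypeEquiv fun U => ?_)
  exact and_congr (nonempty_equiv_congr (e.submoduleMap U))
    (nonempty_equiv_congr (Submodule.Quotient.equiv U _ e rfl))

theorem hallCount_quotient (U : Submodule k[X] N) (lam mu : Ptn) :
    hallCount k (N ⧸ U) lam mu = Nat.card {V : Submodule k[X] N // U ≤ V ∧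
      Nonempty (V.map U.mkQ ≃ₗ[k[X]] NilpModule k mu) ∧
      Nonempty ((N ⧸ V) ≃ₗ[k[X]] NilpModule k lam)} := by
  refine Nat.card_congr ⟨fun W => ⟨W.1.comap U.mkQ, ?_⟩, fun V => ⟨V.1.map U.mkQ, ?_⟩,
    fun W => ?_, fun V => ?_⟩
  · have hW : (W.1.comap U.mkQ).map U.mkQ = W.1 :=
      Submodule.map_comap_eq_of_surjective U.mkQ_surjective _
    have hU : U ≤ W.1.comap U.mkQ := fun x hx => by
      rw [Submodule.mem_comap, Submodule.mkQ_apply, (Submodule.Quotient.mk_eq_zero U).2 hx]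
      exact zero_mem _
    refine ⟨hU, ?_, ?_⟩
    · rw [hW]
      exact W.2.1
    · rw [← nonempty_equiv_congr (Submodule.quotientQuotientEquivQuotient U _ hU), hW]
      exact W.2.2
  · exact ⟨V.2.2.1, (nonempty_equiv_congr
      (Submodule.quotientQuotientEquivQuotient U _ V.2.1)).2 V.2.2.2⟩
  · exact Subtype.ext (Submodule.map_comap_eq_of_surjective U.mkQ_surjective _)
  · refine Subtype.ext ?_
    change (V.1.map U.mkQ).comap U.mkQ = V.1
    rw [Submodule.comap_map_mkQ, sup_eq_right.2 V.2.1]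

/-- The quotient of `V` by its submodule `U`, seen in `N ⧸ U`. -/
noncomputable def quotientComapSubtypeEquiv (U V : Submodule k[X] N) :
    (V ⧸ U.comap V.subtype) ≃ₗ[k[X]] V.map U.mkQ :=
  Submodule.quotEquivOfEq _ _ (by ext x; simp) ≪≫ₗ (U.mkQ.domRestrict V).quotKerEquivRange ≪≫ₗ
    LinearEquiv.ofEq _ _ (LinearMap.range_domRestrict V U.mkQ)

theorem hallCount_submodule (V : Submodule k[X] N) (mu rho : Ptn) :
    hallCount k V mu rho = Nat.card {U : Submodule k[X] N // U ≤ V ∧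
      Nonempty (U ≃ₗ[k[X]] NilpModule k rho) ∧
      Nonempty (V.map U.mkQ ≃ₗ[k[X]] NilpModule k mu)} := by
  have key : ∀ U ≤ V, (Nonempty (U.comap V.subtype ≃ₗ[k[X]] NilpModule k rho) ∧
      Nonempty ((V ⧸ U.comap V.subtype) ≃ₗ[k[X]] NilpModule k mu)) ↔
      Nonempty (U ≃ₗ[k[X]] NilpModule k rho) ∧
      Nonempty (V.map U.mkQ ≃ₗ[k[X]] NilpModule k mu) := fun U hU =>
    and_congr (nonempty_equiv_congr (Submodule.comapSubtypeEquivOfLe hU))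
      (nonempty_equiv_congr (quotientComapSubtypeEquiv U V))
  have hc : ∀ W : Submodule k[X] V, (W.map V.subtype).comap V.subtype = W := fun W =>
    Submodule.comap_map_eq_of_injective V.injective_subtype W
  refine Nat.card_congr ⟨fun W => ⟨W.1.map V.subtype, Submodule.map_subtype_le V _, ?_⟩,
    fun U => ⟨U.1.comap V.subtype, (key _ U.2.1).2 U.2.2⟩, fun W => ?_, fun U => ?_⟩
  · rw [← key _ (Submodule.map_subtype_le V _), hc]
    exact W.2
  · exact Subtype.ext (hc _)
  · refine Subtype.ext ?_
    change (U.1.comap V.subtype).map V.subtype = U.1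
    rw [Submodule.map_comap_subtype, inf_eq_right.2 U.2.1]

variable [Finite k]

/-- A choice of the type of a finite nilpotent module. -/
noncomputable def typeOf (N : Type*) [AddCommGroup N] [Module k[X] N] [Finite N]
    (hN : XNilpotent k N) : Ptn := (exists_equiv_nilpModule k N hN).choose

theorem nonempty_equiv_iff_typeOf_eq [Finite N] (hN : XNilpotent k N) {lam : Ptn} :
    Nonempty (N ≃ₗ[k[X]] NilpModule k lam) ↔ typeOf N hN = lam := by
  obtain ⟨e⟩ := (exists_equiv_nilpModule k N hN).choose_spec
  constructor
  · rintro ⟨f⟩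
    exact ptn_eq_of_equiv k (e.symm.trans f)
  · rintro rfl
    exact ⟨e⟩

theorem hallCount_eq_hallNumber [Finite N] (hN : XNilpotent k N) (lam mu : Ptn) :
    hallCount k N lam mu = hallNumber k lam mu (typeOf N hN) := by
  obtain ⟨e⟩ := (nonempty_equiv_iff_typeOf_eq hN).2 rfl
  exact hallCount_congr e lam mu

-- Both sides count flags `U ≤ V` in `N` with `U` of type `rho`, `V / U` of type `mu` and `N / V` of
-- type `lam`. On the left `nu` is the type of `N / U`, on the right that of `V`.
open Classical in
theorem hallCount_assoc [Finite N] (hN : XNilpotent k N) (lam mu rho : Ptn) :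
    ∑ nu ∈ Ptn.ofSize (lam.size + mu.size), hallNumber k lam mu nu * hallCount k N nu rho =
      ∑ nu ∈ Ptn.ofSize (mu.size + rho.size), hallCount k N lam nu * hallNumber k mu rho nu := by
  have : Fintype (Submodule k[X] N) := Fintype.ofFinite _
  have : ∀ U : Submodule k[X] N, Finite (N ⧸ U) := fun U => Finite.of_surjective _ U.mkQ_surjective
  let st : Submodule k[X] N → Ptn := fun U => typeOf U (hN.submodule U)
  let qt : Submodule k[X] N → Ptn := fun U => typeOf (N ⧸ U) (hN.quotient U)
  have hnum : ∀ a b, hallCount k N a b =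
      ∑ U : Submodule k[X] N, if st U = b ∧ qt U = a then 1 else 0 := by
    intro a b
    rw [hallCount, Finset.sum_boole, Nat.cast_id, Nat.card_eq_fintype_card, Fintype.card_subtype]
    congr 1
    ext U
    simp only [Finset.mem_filter, Finset.mem_univ, true_and]
    exact and_congr (nonempty_equiv_iff_typeOf_eq _) (nonempty_equiv_iff_typeOf_eq _)
  have hcard : ∀ P : Submodule k[X] N → Prop, Nat.card {U // P U} = ∑ U, if P U then 1 else 0 := by
    intro P
    rw [Finset.sum_boole, Nat.cast_id, Nat.card_eq_fintype_card, Fintype.card_subtype]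
  have hleft : ∀ U : Submodule k[X] N, hallNumber k lam mu (qt U) =
      ∑ V : Submodule k[X] N, if U ≤ V ∧ Nonempty (V.map U.mkQ ≃ₗ[k[X]] NilpModule k mu) ∧
        qt V = lam then 1 else 0 := by
    intro U
    rw [← hallCount_eq_hallNumber, hallCount_quotient, hcard]
    simp only [nonempty_equiv_iff_typeOf_eq (hN.quotient _)]
    rfl
  have hright : ∀ V : Submodule k[X] N, hallNumber k mu rho (st V) =
      ∑ U : Submodule k[X] N, if U ≤ V ∧ st U = rho ∧
        Nonempty (V.map U.mkQ ≃ₗ[k[X]] NilpModule k mu) then 1 else 0 := by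
    intro V
    rw [← hallCount_eq_hallNumber, hallCount_submodule, hcard]
    simp only [nonempty_equiv_iff_typeOf_eq (hN.submodule _)]
    rfl
  have h1 : ∑ nu ∈ Ptn.ofSize (lam.size + mu.size),
      hallNumber k lam mu nu * hallCount k N nu rho =
      ∑ U : Submodule k[X] N, if st U = rho then hallNumber k lam mu (qt U) else 0 := by
    simp_rw [hnum, Finset.mul_sum]
    rw [Finset.sum_comm]
    refine Finset.sum_congr rfl fun U _ => ?_
    split_ifs with hU
    · rw [Finset.sum_eq_single (qt U)]
      · simp [hU]
      · intro nu _ hnu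
        simp [hnu.symm]
      -- A type of the wrong size is missing from the sum, but its Hall number is zero.
      · intro hnot
        have : hallNumber k lam mu (qt U) = 0 := by
          by_contra h0
          exact hnot (Ptn.mem_ofSize.2 (size_add_of_hallNumber_ne_zero h0).symm)
        simp [this]
    · simp [hU]
  have h2 : ∑ nu ∈ Ptn.ofSize (mu.size + rho.size),
      hallCount k N lam nu * hallNumber k mu rho nu =
      ∑ V : Submodule k[X] N, if qt V = lam then hallNumber k mu rho (st V) else 0 := by
    simp_rw [hnum, Finset.sum_mul]
    rw [Finset.sum_comm]
    refine Finset.sum_congr rfl fun V _ => ?_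
    split_ifs with hV
    · rw [Finset.sum_eq_single (st V)]
      · simp [hV]
      · intro nu _ hnu
        simp [hnu.symm]
      · intro hnot
        have : hallNumber k mu rho (st V) = 0 := by
          by_contra h0
          exact hnot (Ptn.mem_ofSize.2 (size_add_of_hallNumber_ne_zero h0).symm)
        simp [this]
    · simp [hV]
  rw [h1, h2]
  have h3 : ∀ U : Submodule k[X] N, (if st U = rho then hallNumber k lam mu (qt U) else 0) =
      ∑ V : Submodule k[X] N, if st U = rho ∧ qt V = lam ∧ U ≤ V ∧
        Nonempty (V.map U.mkQ ≃ₗ[k[X]] NilpModule k mu) then 1 else 0 := by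
    intro U
    split_ifs with hU
    · rw [hleft]
      exact Finset.sum_congr rfl fun V _ => if_congr (by tauto) rfl rfl
    · simp [hU]
  have h4 : ∀ V : Submodule k[X] N, (if qt V = lam then hallNumber k mu rho (st V) else 0) =
      ∑ U : Submodule k[X] N, if st U = rho ∧ qt V = lam ∧ U ≤ V ∧
        Nonempty (V.map U.mkQ ≃ₗ[k[X]] NilpModule k mu) then 1 else 0 := by
    intro V
    split_ifs with hV
    · rw [hright]
      exact Finset.sum_congr rfl fun U _ => if_congr (by tauto) rfl rfl
    · simp [hV]
  simp_rw [h3, h4]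
  exact Finset.sum_comm

variable (k)

theorem hallNumber_assoc (lam mu rho xi : Ptn) :
    ∑ nu ∈ Ptn.ofSize (lam.size + mu.size), hallNumber k lam mu nu * hallNumber k nu rho xi =
      ∑ nu ∈ Ptn.ofSize (mu.size + rho.size), hallNumber k lam nu xi * hallNumber k mu rho nu :=
  hallCount_assoc (xNilpotent_nilpModule k xi) lam mu rho

end hallCount

/-! ### The empty partition as unit -/

section unit

variable (k : Type) [Field k]

theorem quotient_equiv_empty_iff {N : Type*} [AddCommGroup N] [Module k[X] N]
    (U : Submodule k[X] N) :
    Nonempty ((N ⧸ U) ≃ₗ[k[X]] NilpModule k Ptn.empty) ↔ U = ⊤ := by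
  have hs : Subsingleton (NilpModule k Ptn.empty) := by
    refine (Nat.card_eq_one_iff_unique.1 ?_).1
    rw [natCard_nilpModule, Ptn.size_empty, pow_zero]
  rw [← Submodule.Quotient.subsingleton_iff]
  constructor
  · rintro ⟨e⟩
    exact e.toEquiv.subsingleton
  · intro h
    exact ⟨LinearEquiv.ofSubsingleton _ _⟩

theorem hallNumber_empty_self [Finite k] (mu : Ptn) : hallNumber k Ptn.empty mu mu = 1 := by
  refine Nat.card_eq_one_iff_unique.2 ⟨⟨fun U V => Subtype.ext ?_⟩, ⟨⊤, ?_, ?_⟩⟩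
  · rw [(quotient_equiv_empty_iff k _).1 U.2.2, (quotient_equiv_empty_iff k _).1 V.2.2]
  · exact ⟨Submodule.topEquiv⟩
  · exact (quotient_equiv_empty_iff k _).2 rfl

theorem hallNumber_empty_ne [Finite k] {mu xi : Ptn} (h : mu ≠ xi) : hallNumber k Ptn.empty mu xi = 0 := by
  by_contra h0
  obtain ⟨U, ⟨e⟩, hU⟩ := exists_of_hallNumber_ne_zero h0
  rw [quotient_equiv_empty_iff] at hU
  subst hU
  exact h (ptn_eq_of_equiv k (e.symm.trans Submodule.topEquiv))

end unit

/-! ### Duality and commutativity of Hall numbers -/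

section duality

variable (k : Type) [Field k]

/-- The functional on `k[T] / (T ^ n)` given by the coefficient of `T ^ (n - 1)`. -/
noncomputable def topCoeff (n : ℕ) : CyclicModule k n →ₗ[k] k :=
  (Submodule.liftQ ((Ideal.span {(Polynomial.X : k[X]) ^ n}).restrictScalars k)
    -- Taking coefficient `n` of `T * f` instead of coefficient `n - 1` of `f` gives the zero
    -- functional for `n = 0`.
    ((Polynomial.lcoeff k n).comp (LinearMap.mulLeft k (Polynomial.X : k[X]))) (by
      intro f hf
      obtain ⟨g, rfl⟩ := Ideal.mem_span_singleton.1 hf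
      rw [LinearMap.mem_ker, LinearMap.comp_apply, LinearMap.mulLeft_apply,
        Polynomial.lcoeff_apply, ← mul_assoc, ← pow_succ', Polynomial.coeff_X_pow_mul']
      simp)).comp
  (Submodule.Quotient.restrictScalarsEquiv k
    (Ideal.span {(Polynomial.X : k[X]) ^ n})).symm.toLinearMap

theorem topCoeff_mk (n : ℕ) (f : k[X]) :
    topCoeff k n (Ideal.Quotient.mk _ f) = (Polynomial.X * f).coeff n := rfl

theorem eq_zero_of_topCoeff_mul {n : ℕ} {x : CyclicModule k n}
    (h : ∀ y, topCoeff k n (x * y) = 0) : x = 0 := by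
  obtain ⟨f, rfl⟩ := Ideal.Quotient.mk_surjective x
  rw [Ideal.Quotient.eq_zero_iff_mem, Ideal.mem_span_singleton, Polynomial.X_pow_dvd_iff]
  intro d hd
  -- Multiplication by this power moves the coefficient of degree `d` into the top degree.
  have := h (Ideal.Quotient.mk _ (Polynomial.X ^ (n - 1 - d)))
  rw [← map_mul, topCoeff_mk, mul_left_comm, ← pow_succ', Polynomial.coeff_mul_X_pow',
    if_pos (by omega)] at this
  rwa [show n - (n - 1 - d + 1) = d by omega] at this

/-- The symmetric nondegenerate form on `M_xi` for which `T` is self-adjoint. -/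
noncomputable def nilpForm (xi : Ptn) : LinearMap.BilinForm k (NilpModule k xi) :=
  LinearMap.mk₂ k (fun x y => ∑ j, topCoeff k j.1 (x j * y j))
    (fun x x' y => by simp [add_mul, Finset.sum_add_distrib])
    (fun c x y => by
      rw [Finset.smul_sum]
      refine Finset.sum_congr rfl fun j _ => ?_
      rw [← map_smul]
      exact congrArg _ (Algebra.smul_mul_assoc c (x j) (y j)))
    (fun x y y' => by simp [mul_add, Finset.sum_add_distrib])
    (fun c x y => by
      rw [Finset.smul_sum]
      refine Finset.sum_congr rfl fun j _ => ?_
      rw [← map_smul]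
      exact congrArg _ (Algebra.mul_smul_comm c (x j) (y j)))

variable {k} {xi : Ptn}

theorem nilpForm_apply (x y : NilpModule k xi) :
    nilpForm k xi x y = ∑ j, topCoeff k j.1 (x j * y j) := rfl

theorem nilpForm_comm (x y : NilpModule k xi) : nilpForm k xi x y = nilpForm k xi y x := by
  simp only [nilpForm_apply, mul_comm]

theorem nilpForm_smul (p : k[X]) (x y : NilpModule k xi) :
    nilpForm k xi (p • x) y = nilpForm k xi x (p • y) := by
  simp only [nilpForm_apply, Pi.smul_apply, smul_mul_assoc, mul_smul_comm]

theorem nilpForm_isRefl : (nilpForm k xi).IsRefl := fun x y h => by rwa [nilpForm_comm]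

theorem nilpForm_nondegenerate : (nilpForm k xi).Nondegenerate := by
  have hleft : ∀ x, (∀ y, nilpForm k xi x y = 0) → x = 0 := by
    intro x h
    funext j
    refine eq_zero_of_topCoeff_mul k fun y => ?_
    classical
    have := h (Pi.single j y)
    rw [nilpForm_apply, Finset.sum_eq_single j] at this
    · simpa using this
    · intro i _ hi
      simp [Pi.single_eq_of_ne hi]
    · simp
  exact ⟨hleft, fun y h => hleft y fun x => by rw [nilpForm_comm]; exact h x⟩

/-- The orthogonal complement of a submodule of `M_xi`. -/
noncomputable def perp (U : Submodule k[X] (NilpModule k xi)) :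
    Submodule k[X] (NilpModule k xi) where
  carrier := {y | ∀ x ∈ U, nilpForm k xi x y = 0}
  add_mem' := fun {a b} ha hb x hx => by rw [map_add, ha x hx, hb x hx, add_zero]
  zero_mem' := fun x _ => map_zero _
  smul_mem' := fun p y hy x hx => by rw [← nilpForm_smul]; exact hy _ (U.smul_mem p hx)

theorem perp_restrictScalars (U : Submodule k[X] (NilpModule k xi)) :
    (perp U).restrictScalars k = (nilpForm k xi).orthogonal (U.restrictScalars k) := rfl

variable [Finite k]

theorem perp_perp (U : Submodule k[X] (NilpModule k xi)) : perp (perp U) = U := by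
  apply Submodule.restrictScalars_injective k
  rw [perp_restrictScalars, perp_restrictScalars,
    LinearMap.BilinForm.orthogonal_orthogonal nilpForm_nondegenerate nilpForm_isRefl]

theorem card_perp_mul_card (U : Submodule k[X] (NilpModule k xi)) :
    Nat.card (perp U) * Nat.card U = Nat.card (NilpModule k xi) := by
  change Nat.card ((perp U).restrictScalars k) * Nat.card (U.restrictScalars k) = _
  rw [perp_restrictScalars, Module.natCard_eq_pow_finrank (K := k),
    Module.natCard_eq_pow_finrank (K := k) (V := U.restrictScalars k),
    Module.natCard_eq_pow_finrank (K := k) (V := NilpModule k xi), ← pow_add,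
    LinearMap.BilinForm.finrank_orthogonal nilpForm_nondegenerate,
    Nat.sub_add_cancel (Submodule.finrank_le _)]

/-- Multiplication by `T ^ i`. -/
noncomputable abbrev powMul (xi : Ptn) (i : ℕ) : NilpModule k xi →ₗ[k[X]] NilpModule k xi :=
  LinearMap.lsmul k[X] (NilpModule k xi) (Polynomial.X ^ i)

omit [Finite k] in
theorem card_powRange_mul_card_ker (i : ℕ) :
    Nat.card (powRange k (NilpModule k xi) i) * Nat.card (LinearMap.ker (powMul (k := k) xi i)) =
      Nat.card (NilpModule k xi) := by
  have := card_map_mul_card_inf_ker (powMul (k := k) xi i) ⊤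
  rw [Submodule.map_top, top_inf_eq] at this
  exact this.trans (Nat.card_congr Submodule.topEquiv.toEquiv)

/-- Self-adjointness of `T ^ i` gives one inclusion, and the two sides have the same order. -/
theorem perp_ker (i : ℕ) :
    perp (LinearMap.ker (powMul (k := k) xi i)) = powRange k (NilpModule k xi) i := by
  symm
  have hle : powRange k (NilpModule k xi) i ≤ perp (LinearMap.ker (powMul (k := k) xi i)) := by
    intro y hy x hx
    obtain ⟨z, rfl⟩ := mem_powRange.1 hy
    rw [← nilpForm_smul]
    have : (Polynomial.X ^ i : k[X]) • x = 0 := hx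
    rw [this, map_zero, LinearMap.zero_apply]
  refine SetLike.coe_injective (Set.eq_of_subset_of_ncard_le hle ?_ (Set.toFinite _))
  rw [← Nat.card_coe_set_eq, ← Nat.card_coe_set_eq]
  refine le_of_eq (Nat.eq_of_mul_eq_mul_right
    (Nat.card_pos (α := LinearMap.ker (powMul (k := k) xi i))) ?_)
  exact (card_perp_mul_card _).trans (card_powRange_mul_card_ker i).symm

theorem powRange_inf_perp (U : Submodule k[X] (NilpModule k xi)) (i : ℕ) :
    powRange k (NilpModule k xi) i ⊓ perp U = perp (U ⊔ LinearMap.ker (powMul (k := k) xi i)) := by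
  rw [← perp_ker]
  ext y
  rw [Submodule.mem_inf]
  constructor
  · rintro ⟨h1, h2⟩ x hx
    obtain ⟨a, ha, b, hb, rfl⟩ := Submodule.mem_sup.1 hx
    rw [map_add, LinearMap.add_apply, h1 b hb, h2 a ha, add_zero]
  · intro h
    exact ⟨fun x hx => h x (Submodule.mem_sup_right hx), fun x hx => h x (Submodule.mem_sup_left hx)⟩

omit [Finite k] in
theorem map_powMul (U : Submodule k[X] (NilpModule k xi)) (i : ℕ) :
    U.map (powMul xi i) = (powRange k U i).map U.subtype := by
  ext y
  simp only [Submodule.mem_map, mem_powRange]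
  constructor
  · rintro ⟨x, hx, rfl⟩
    exact ⟨_, ⟨⟨x, hx⟩, rfl⟩, rfl⟩
  · rintro ⟨_, ⟨x, rfl⟩, rfl⟩
    exact ⟨x, x.2, rfl⟩

/-- With `K` the kernel of `T ^ i` on the whole module `M`, `T ^ i M ⊓ perp U = perp (U ⊔ K)`. So
the left side is `|M| / |K|` divided by `|M| / |U ⊔ K|`, which is the order of the image of `U`
under `T ^ i`. This identifies the type of `M ⧸ perp U` without constructing a dual module. -/
theorem card_powRange_quotient_perp (U : Submodule k[X] (NilpModule k xi)) (i : ℕ) :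
    Nat.card (powRange k (NilpModule k xi ⧸ perp U) i) = Nat.card (powRange k U i) := by
  set K := LinearMap.ker (powMul (k := k) xi i)
  have h1 := card_powRange_quotient_mul (perp U) i
  have h2 := card_perp_mul_card (U ⊔ K)
  have h3 := card_powRange_mul_card_ker (k := k) (xi := xi) i
  have h4 := card_map_mul_card_inf_ker (powMul (k := k) xi i) (U ⊔ K)
  have hm : (U ⊔ K).map (powMul (k := k) xi i) = (powRange k U i).map U.subtype := by
    rw [Submodule.map_sup, LinearMap.le_ker_iff_map.1 (le_refl K), sup_bot_eq, map_powMul]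
  rw [inf_eq_right.2 le_sup_right, hm,
    ← Nat.card_congr (Submodule.equivMapOfInjective _ U.injective_subtype _).toEquiv] at h4
  rw [powRange_inf_perp] at h1
  have hK : 0 < Nat.card K := Nat.card_pos
  have hP : 0 < Nat.card (perp (U ⊔ K)) := Nat.card_pos
  refine Nat.eq_of_mul_eq_mul_right (mul_pos hP hK) ?_
  rw [← mul_assoc, h1, h3, ← h2, ← h4]
  ring

theorem quotient_perp_equiv_iff (U : Submodule k[X] (NilpModule k xi)) {lam : Ptn} :
    Nonempty ((NilpModule k xi ⧸ perp U) ≃ₗ[k[X]] NilpModule k lam) ↔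
      Nonempty (U ≃ₗ[k[X]] NilpModule k lam) := by
  have hN := xNilpotent_nilpModule k xi
  have : Finite (NilpModule k xi ⧸ perp U) := Finite.of_surjective _ (perp U).mkQ_surjective
  rw [equiv_nilpModule_iff k (hN.quotient _), equiv_nilpModule_iff k (hN.submodule _)]
  simp only [card_powRange_quotient_perp]

variable (k)

theorem hallNumber_comm (lam mu xi : Ptn) : hallNumber k lam mu xi = hallNumber k mu lam xi := by
  let e : Submodule k[X] (NilpModule k xi) ≃ Submodule k[X] (NilpModule k xi) :=
    ⟨perp, perp, perp_perp, perp_perp⟩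
  refine Nat.card_congr (e.subtypeEquiv fun U => ?_)
  change _ ↔ Nonempty (perp U ≃ₗ[k[X]] _) ∧ Nonempty ((NilpModule k xi ⧸ perp U) ≃ₗ[k[X]] _)
  rw [quotient_perp_equiv_iff, ← quotient_perp_equiv_iff (perp U), perp_perp, and_comm]

end duality

/-! ### Cyclic submodules and the levels of their generators -/

section level

variable {k : Type} [Field k] {N : Type*} [AddCommGroup N] [Module k[X] N]

theorem ideal_eq_span_X_pow {I : Ideal k[X]} {m : ℕ} (h : Polynomial.X ^ m ∈ I) :
    ∃ s, I = Ideal.span {(Polynomial.X : k[X]) ^ s} := by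
  obtain ⟨g, rfl⟩ := (inferInstance : I.IsPrincipal)
  obtain ⟨s, -, hs⟩ := (dvd_prime_pow Polynomial.prime_X m).1 (Ideal.mem_span_singleton.1 h)
  exact ⟨s, Ideal.span_singleton_eq_span_singleton.2 hs⟩

/-- The least `a` with `T ^ a x ∈ V`. -/
noncomputable def level (V : Submodule k[X] N) (x : N) : ℕ :=
  sInf {a | (Polynomial.X ^ a : k[X]) • x ∈ V}

theorem comap_toSpanSingleton (hN : XNilpotent k N) (V : Submodule k[X] N) (x : N) :
    V.comap (LinearMap.toSpanSingleton k[X] N x) =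
      Ideal.span {(Polynomial.X : k[X]) ^ level V x} := by
  obtain ⟨m, hm⟩ := hN
  obtain ⟨s, hs⟩ := ideal_eq_span_X_pow (I := V.comap (LinearMap.toSpanSingleton k[X] N x))
    (m := m) (by
      rw [Submodule.mem_comap, LinearMap.toSpanSingleton_apply, hm]
      exact zero_mem _)
  have h : {a | (Polynomial.X ^ a : k[X]) • x ∈ V} = Set.Ici s := by
    ext a
    have : (Polynomial.X ^ a : k[X]) ∈ V.comap (LinearMap.toSpanSingleton k[X] N x) ↔ s ≤ a := by
      rw [hs, Ideal.mem_span_singleton, pow_dvd_pow_iff Polynomial.X_ne_zero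
        Polynomial.not_isUnit_X]
    exact this
  rw [level, h, csInf_Ici, hs]

theorem pow_smul_mem_iff (hN : XNilpotent k N) {V : Submodule k[X] N} {x : N} {a : ℕ} :
    (Polynomial.X ^ a : k[X]) • x ∈ V ↔ level V x ≤ a := by
  have : (Polynomial.X ^ a : k[X]) ∈ V.comap (LinearMap.toSpanSingleton k[X] N x) ↔
      level V x ≤ a := by
    rw [comap_toSpanSingleton hN, Ideal.mem_span_singleton,
      pow_dvd_pow_iff Polynomial.X_ne_zero Polynomial.not_isUnit_X]
  exact this

theorem pow_smul_eq_zero_iff (hN : XNilpotent k N) {x : N} {a : ℕ} :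
    (Polynomial.X ^ a : k[X]) • x = 0 ↔ level (⊥ : Submodule k[X] N) x ≤ a := by
  rw [← pow_smul_mem_iff hN, Submodule.mem_bot]

/-- The submodule generated by `x` is a cyclic module of length `level ⊥ x`. -/
noncomputable def spanSingletonEquiv (hN : XNilpotent k N) (x : N) :
    Submodule.span k[X] {x} ≃ₗ[k[X]] CyclicModule k (level (⊥ : Submodule k[X] N) x) :=
  (Submodule.quotEquivOfEq _ _ (comap_toSpanSingleton hN ⊥ x).symm ≪≫ₗ
    (LinearMap.toSpanSingleton k[X] N x).quotKerEquivRange ≪≫ₗ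
    LinearEquiv.ofEq _ _ (LinearMap.range_toSpanSingleton x)).symm

theorem card_span_singleton (hN : XNilpotent k N) (x : N) :
    Nat.card (Submodule.span k[X] {x}) = Nat.card k ^ level (⊥ : Submodule k[X] N) x := by
  rw [Nat.card_congr (spanSingletonEquiv hN x).toEquiv, natCard_cyclicModule]

theorem inf_span_singleton (hN : XNilpotent k N) (V : Submodule k[X] N) (x : N) :
    V ⊓ Submodule.span k[X] {x} =
      Submodule.span k[X] {(Polynomial.X ^ level V x : k[X]) • x} := by
  apply le_antisymm
  · rintro y ⟨hy, hx⟩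
    obtain ⟨f, rfl⟩ := Submodule.mem_span_singleton.1 hx
    have hf : f ∈ V.comap (LinearMap.toSpanSingleton k[X] N x) := hy
    rw [comap_toSpanSingleton hN, Ideal.mem_span_singleton] at hf
    obtain ⟨g, rfl⟩ := hf
    exact Submodule.mem_span_singleton.2 ⟨g, by rw [smul_smul, mul_comm]⟩
  · rw [Submodule.span_singleton_le_iff_mem]
    exact ⟨(pow_smul_mem_iff hN).2 le_rfl,
      Submodule.smul_mem _ _ (Submodule.mem_span_singleton_self x)⟩

theorem level_bot_pow_smul (hN : XNilpotent k N) (x : N) (l : ℕ) :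
    level (⊥ : Submodule k[X] N) ((Polynomial.X ^ l : k[X]) • x) =
      level (⊥ : Submodule k[X] N) x - l := by
  refine eq_of_forall_ge_iff fun a => ?_
  rw [← pow_smul_eq_zero_iff hN, smul_smul, ← pow_add, pow_smul_eq_zero_iff hN]
  omega

theorem card_inf_span_singleton (hN : XNilpotent k N) (V : Submodule k[X] N) (x : N) :
    Nat.card (V ⊓ Submodule.span k[X] {x} : Submodule k[X] N) =
      Nat.card k ^ (level (⊥ : Submodule k[X] N) x - level V x) := by
  rw [inf_span_singleton hN, card_span_singleton hN, level_bot_pow_smul hN]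

end level

/-! ### Counting cyclic submodules by generators -/

section cyclic

variable {k : Type} [Field k]

theorem xNilpotent_cyclicModule (n : ℕ) : XNilpotent k (CyclicModule k n) :=
  ⟨n, fun x => (eq_zero_iff_mem_powRange k le_rfl).1 (pow_smul_mem_powRange n x)⟩

theorem mem_powRange_cyclicModule_iff {n c : ℕ} (hc : c ≤ n) {y : CyclicModule k n} :
    y ∈ powRange k (CyclicModule k n) c ↔
      level (⊥ : Submodule k[X] (CyclicModule k n)) y ≤ n - c := by
  rw [← pow_smul_eq_zero_iff (xNilpotent_cyclicModule n), ← eq_zero_iff_mem_powRange k le_rfl,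
    pow_smul_mem_powRange_iff, min_self, Nat.sub_sub_self hc]

theorem level_bot_le (n : ℕ) (y : CyclicModule k n) :
    level (⊥ : Submodule k[X] (CyclicModule k n)) y ≤ n := by
  have := (mem_powRange_cyclicModule_iff (k := k) (Nat.zero_le n) (y := y)).1 (by simp)
  simpa using this

variable [Finite k]

theorem cyclicModule_equiv_iff {s r : ℕ} (hr : 0 < r) :
    Nonempty (CyclicModule k s ≃ₗ[k[X]] NilpModule k (Ptn.single r)) ↔ s = r := by
  rw [equiv_nilpModule_iff k (xNilpotent_cyclicModule s)]
  simp only [card_powRange_cyclicModule, Ptn.rk_single hr]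
  constructor
  · intro h
    exact Nat.pow_right_injective (one_lt_natCard k) (h 0)
  · rintro rfl i
    rfl

theorem span_singleton_equiv_iff {N : Type*} [AddCommGroup N] [Module k[X] N]
    (hN : XNilpotent k N) {r : ℕ} (hr : 0 < r) (x : N) :
    Nonempty (Submodule.span k[X] {x} ≃ₗ[k[X]] NilpModule k (Ptn.single r)) ↔
      level (⊥ : Submodule k[X] N) x = r := by
  rw [nonempty_equiv_congr (spanSingletonEquiv hN x), cyclicModule_equiv_iff hr]

/-- The intersection of `T ^ i M` with the span of `x` is generated by `T ^ l • x`, `l` being the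
level of `x` over `T ^ i M`. Thus the cotype is read off from the levels of the generator. -/
theorem quotient_span_singleton_equiv_iff {lam xi : Ptn} (x : NilpModule k xi) :
    Nonempty ((NilpModule k xi ⧸ Submodule.span k[X] {x}) ≃ₗ[k[X]] NilpModule k lam) ↔
      ∀ i, lam.rk i + (level (⊥ : Submodule k[X] (NilpModule k xi)) x -
        level (powRange k (NilpModule k xi) i) x) = xi.rk i := by
  have hN := xNilpotent_nilpModule k xi
  have : Finite (NilpModule k xi ⧸ Submodule.span k[X] {x}) :=
    Finite.of_surjective _ (Submodule.span k[X] {x}).mkQ_surjective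
  rw [equiv_nilpModule_iff k (hN.quotient _)]
  refine forall_congr' fun i => ?_
  have h := card_powRange_quotient_mul (Submodule.span k[X] {x}) i
  rw [card_inf_span_singleton hN, card_powRange_nilpModule] at h
  have hinj : ∀ a b : ℕ, Nat.card k ^ a = Nat.card k ^ b ↔ a = b := fun _ _ =>
    (Nat.pow_right_injective (one_lt_natCard k)).eq_iff
  rw [← hinj _ (xi.rk i), pow_add, ← h]
  exact eq_comm.trans (Nat.mul_left_inj (pow_ne_zero _ (Nat.card_pos (α := k)).ne')).symm

theorem span_singleton_eq_top_iff {r : ℕ} (hr : 0 < r) (z : CyclicModule k r) :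
    Submodule.span k[X] {z} = ⊤ ↔ z ∉ powRange k (CyclicModule k r) 1 := by
  have hN := xNilpotent_cyclicModule (k := k) r
  have hle := level_bot_le r z
  rw [mem_powRange_cyclicModule_iff hr]
  have h1 : Submodule.span k[X] {z} = ⊤ ↔
      level (⊥ : Submodule k[X] (CyclicModule k r)) z = r := by
    rw [← (Nat.pow_right_injective (one_lt_natCard k)).eq_iff]
    rw [← card_span_singleton hN]
    constructor
    · intro h
      rw [h, Nat.card_congr Submodule.topEquiv.toEquiv, natCard_cyclicModule]
    · intro h
      refine SetLike.coe_injective (Set.eq_of_subset_of_ncard_le (Set.subset_univ _) ?_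
        (Set.toFinite _))
      rw [Submodule.top_coe, Set.ncard_univ, natCard_cyclicModule, ← h, ← Nat.card_coe_set_eq]
      rfl
  rw [h1]
  omega

/-- The generators of a cyclic module of length `r` are the elements outside its unique maximal
submodule, the multiples of `T`. -/
theorem card_generators {r : ℕ} (hr : 0 < r) {N : Type*} [AddCommGroup N] [Module k[X] N]
    (U : Submodule k[X] N) (hU : Nonempty (U ≃ₗ[k[X]] NilpModule k (Ptn.single r))) :
    Nat.card {x : N // Submodule.span k[X] {x} = U} + Nat.card k ^ (r - 1) = Nat.card k ^ r := by
  obtain ⟨f⟩ := hU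
  obtain ⟨e⟩ := (cyclicModule_equiv_iff (k := k) (s := r) hr).2 rfl
  let g : CyclicModule k r →ₗ[k[X]] N := U.subtype.comp (e.trans f.symm).toLinearMap
  have hg : Function.Injective g := U.injective_subtype.comp (e.trans f.symm).injective
  have hrange : LinearMap.range g = U := by
    rw [LinearMap.range_comp, LinearEquiv.range, Submodule.map_top, Submodule.range_subtype]
  have hset : {x : N | Submodule.span k[X] {x} = U} =
      g '' (powRange k (CyclicModule k r) 1 : Set (CyclicModule k r))ᶜ := by
    have key : ∀ z, Submodule.span k[X] {g z} = U ↔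
        z ∈ (powRange k (CyclicModule k r) 1 : Set (CyclicModule k r))ᶜ := by
      intro z
      rw [Set.mem_compl_iff, SetLike.mem_coe, ← span_singleton_eq_top_iff hr,
        ← Set.image_singleton, ← Submodule.map_span, ← hrange, ← Submodule.map_top,
        (Submodule.map_injective_of_injective hg).eq_iff]
    ext x
    constructor
    · intro hx
      have hxU : x ∈ LinearMap.range g := by
        rw [hrange, ← show Submodule.span k[X] {x} = U from hx]
        exact Submodule.mem_span_singleton_self x
      obtain ⟨z, rfl⟩ := hxU
      exact ⟨z, (key z).1 hx, rfl⟩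
    · rintro ⟨z, hz, rfl⟩
      exact (key z).2 hz
  have h1 : Nat.card {x : N // Submodule.span k[X] {x} = U} =
      (powRange k (CyclicModule k r) 1 : Set (CyclicModule k r))ᶜ.ncard := by
    rw [← Set.ncard_image_of_injective _ hg, ← hset, ← Nat.card_coe_set_eq]
    rfl
  rw [h1, ← card_powRange_cyclicModule k r 1, ← natCard_cyclicModule k r, add_comm,
    ← Set.ncard_add_ncard_compl (powRange k (CyclicModule k r) 1 : Set (CyclicModule k r)),
    ← Nat.card_coe_set_eq]
  rfl

/-- The elements on the right are fibred over the submodules counted by the Hall number, by `x ↦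
span {x}`; the fibres are the sets of generators. -/
theorem card_mul_hallNumber_single {r : ℕ} (hr : 0 < r) (lam xi : Ptn) :
    ((Nat.card k : ℤ) ^ r - (Nat.card k : ℤ) ^ (r - 1)) * hallNumber k lam (Ptn.single r) xi =
      Nat.card {x : NilpModule k xi //
        level (⊥ : Submodule k[X] (NilpModule k xi)) x = r ∧ ∀ i,
          lam.rk i + (r - level (powRange k (NilpModule k xi) i) x) = xi.rk i} := by
  have hN := xNilpotent_nilpModule k xi
  let S := {U : Submodule k[X] (NilpModule k xi) //
    Nonempty (U ≃ₗ[k[X]] NilpModule k (Ptn.single r)) ∧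
      Nonempty ((NilpModule k xi ⧸ U) ≃ₗ[k[X]] NilpModule k lam)}
  let Y := {x : NilpModule k xi //
        level (⊥ : Submodule k[X] (NilpModule k xi)) x = r ∧ ∀ i,
          lam.rk i + (r - level (powRange k (NilpModule k xi) i) x) = xi.rk i}
  have hY : ∀ x : NilpModule k xi, (level (⊥ : Submodule k[X] (NilpModule k xi)) x = r ∧ ∀ i,
      lam.rk i + (r - level (powRange k (NilpModule k xi) i) x) = xi.rk i) ↔
      (Nonempty (Submodule.span k[X] {x} ≃ₗ[k[X]] NilpModule k (Ptn.single r)) ∧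
      Nonempty ((NilpModule k xi ⧸ Submodule.span k[X] {x}) ≃ₗ[k[X]] NilpModule k lam)) := by
    intro x
    rw [span_singleton_equiv_iff hN hr, quotient_span_singleton_equiv_iff]
    constructor
    · rintro ⟨rfl, h⟩
      exact ⟨rfl, h⟩
    · rintro ⟨rfl, h⟩
      exact ⟨rfl, h⟩
  let e : Y ≃ Σ U : S, {x : NilpModule k xi // Submodule.span k[X] {x} = U.1} :=
    ⟨fun x => ⟨⟨_, (hY x.1).1 x.2⟩, ⟨x.1, rfl⟩⟩,
      fun p => ⟨p.2.1, (hY p.2.1).2 (by rw [p.2.2]; exact p.1.2)⟩, fun x => rfl, by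
        rintro ⟨⟨U, hU⟩, x⟩
        obtain ⟨x, hx : _ = U⟩ := x
        subst hx
        rfl⟩
  have hfin : Fintype S := Fintype.ofFinite S
  change _ = (Nat.card Y : ℤ)
  rw [Nat.card_congr e, Nat.card_sigma, Nat.cast_sum]
  have : ∀ U : S, (Nat.card {x : NilpModule k xi // Submodule.span k[X] {x} = U.1} : ℤ) =
      (Nat.card k : ℤ) ^ r - (Nat.card k : ℤ) ^ (r - 1) := fun U => by
    rw [eq_sub_iff_add_eq]
    exact_mod_cast card_generators hr U.1 U.2.1
  rw [Finset.sum_congr rfl fun U _ => this U, Finset.sum_const, nsmul_eq_mul, mul_comm,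
    Finset.card_univ, ← Nat.card_eq_fintype_card]
  rfl

end cyclic

/-! ### Polynomiality for one-row type -/

section levelVector

variable (k : Type) [Field k]

/-- The levels of the coordinates of an element of `M_xi`. -/
noncomputable def levelVector {xi : Ptn} (x : NilpModule k xi) : xi.parts.ToType → ℕ :=
  fun j => level (⊥ : Submodule k[X] (CyclicModule k j.1)) (x j)

variable {k}

theorem pow_smul_mem_powRange_nilpModule_iff {xi : Ptn} {a i : ℕ} {x : NilpModule k xi} :
    (Polynomial.X ^ a : k[X]) • x ∈ powRange k (NilpModule k xi) i ↔
      ∀ j : xi.parts.ToType, x j ∈ powRange k (CyclicModule k j.1) (min i j.1 - a) := by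
  rw [mem_powRange_pi]
  exact forall_congr' fun j => pow_smul_mem_powRange_iff k (y := x j)

theorem pow_smul_cyclicModule_eq_zero_iff {n a : ℕ} {y : CyclicModule k n} :
    (Polynomial.X ^ a : k[X]) • y = 0 ↔ y ∈ powRange k (CyclicModule k n) (n - a) := by
  rw [← eq_zero_iff_mem_powRange k le_rfl, pow_smul_mem_powRange_iff, min_self]

theorem pow_smul_nilpModule_eq_zero_iff {xi : Ptn} {a : ℕ} {x : NilpModule k xi} :
    (Polynomial.X ^ a : k[X]) • x = 0 ↔
      ∀ j : xi.parts.ToType, x j ∈ powRange k (CyclicModule k j.1) (j.1 - a) := by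
  rw [funext_iff]
  exact forall_congr' fun j => pow_smul_cyclicModule_eq_zero_iff (y := x j)

/-- Together with `level_powRange_eq` this expresses the conditions on a generator by its level
vector alone, in terms that do not mention the field. -/
theorem level_bot_eq {xi : Ptn} (x : NilpModule k xi) :
    level (⊥ : Submodule k[X] (NilpModule k xi)) x =
      sInf {a | ∀ j, levelVector k x j ≤ j.1 - (j.1 - a)} := by
  rw [level]
  congr 1
  ext a
  simp only [Set.mem_ofPred_eq, Submodule.mem_bot]
  rw [pow_smul_nilpModule_eq_zero_iff]
  exact forall_congr' fun j => mem_powRange_cyclicModule_iff (Nat.sub_le _ _)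

theorem level_powRange_eq {xi : Ptn} (x : NilpModule k xi) (i : ℕ) :
    level (powRange k (NilpModule k xi) i) x =
      sInf {a | ∀ j, levelVector k x j ≤ j.1 - (min i j.1 - a)} := by
  rw [level]
  congr 1
  ext a
  simp only [Set.mem_ofPred_eq]
  rw [pow_smul_mem_powRange_nilpModule_iff]
  exact forall_congr' fun j => mem_powRange_cyclicModule_iff (by omega)

theorem levelVector_le {xi : Ptn} (x : NilpModule k xi) (j : xi.parts.ToType) :
    levelVector k x j ≤ j.1 := level_bot_le _ _

end levelVector

/-- The elements of level at most `w` form `T ^ (n - w)` times the module and number `q ^ w`; level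
exactly `w` is a difference of two such counts, or the count `1` for `w = 0`. -/
theorem isPolyCount_level {n w : ℕ} (hw : w ≤ n) : IsPolyCount fun k _ _ =>
    (Nat.card {y : CyclicModule k n //
      level (⊥ : Submodule k[X] (CyclicModule k n)) y = w} : ℤ) := by
  have key : ∀ (k : Type) [Field k] [Finite k] (w : ℕ), w ≤ n →
      {y : CyclicModule k n | level (⊥ : Submodule k[X] (CyclicModule k n)) y ≤ w}.ncard =
        Nat.card k ^ w := by
    intro k _ _ w hw
    have : {y : CyclicModule k n | level (⊥ : Submodule k[X] (CyclicModule k n)) y ≤ w} =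
        (powRange k (CyclicModule k n) (n - w) : Set (CyclicModule k n)) := by
      ext y
      rw [SetLike.mem_coe, mem_powRange_cyclicModule_iff (Nat.sub_le _ _), Nat.sub_sub_self hw]
      rfl
    rw [this, ← Nat.card_coe_set_eq]
    refine (card_powRange_cyclicModule k n (n - w)).trans ?_
    rw [Nat.sub_sub_self hw]
  obtain _ | w := w
  · obtain ⟨P, hP⟩ := IsPolyCount.const 1
    refine ⟨P, fun k _ _ => (hP k).trans ?_⟩
    have := key k 0 hw
    simp only [Nat.le_zero, pow_zero] at this
    rw [← Nat.cast_one, ← this, ← Nat.card_coe_set_eq]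
    rfl
  · obtain ⟨P, hP⟩ := (IsPolyCount.card_pow (w + 1)).sub (IsPolyCount.card_pow w)
    refine ⟨P, fun k _ _ => (hP k).trans ?_⟩
    rw [sub_eq_iff_eq_add]
    have h1 := key k (w + 1) hw
    have h2 := key k w (by omega)
    have h3 : {y : CyclicModule k n | level (⊥ : Submodule k[X] (CyclicModule k n)) y ≤ w + 1} =
        {y | level (⊥ : Submodule k[X] (CyclicModule k n)) y = w + 1} ∪
        {y | level (⊥ : Submodule k[X] (CyclicModule k n)) y ≤ w} := by
      ext y
      simp only [Set.mem_ofPred_eq, Set.mem_union]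
      omega
    have h4 : Disjoint
        {y : CyclicModule k n | level (⊥ : Submodule k[X] (CyclicModule k n)) y = w + 1}
        {y | level (⊥ : Submodule k[X] (CyclicModule k n)) y ≤ w} := by
      refine Set.disjoint_left.2 fun y h h' => ?_
      simp only [Set.mem_ofPred_eq] at h h'
      omega
    rw [h3, Set.ncard_union_eq h4, h2,
      ← Nat.card_coe_set_eq] at h1
    beta_reduce
    exact_mod_cast h1.symm

-- The condition `C` is the same for all fields and only finitely many level vectors occur. Each
-- contributes a product of the counts for single coordinates.
open Classical in
theorem isPolyCount_levelVector (xi : Ptn) (C : (xi.parts.ToType → ℕ) → Prop) :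
    IsPolyCount fun k _ _ => (Nat.card {x : NilpModule k xi // C (levelVector k x)} : ℤ) := by
  let W : Finset (xi.parts.ToType → ℕ) := (Fintype.piFinset fun j => Finset.range (j.1 + 1)).filter C
  obtain ⟨P, hP⟩ := IsPolyCount.sum W fun w hw => IsPolyCount.prod Finset.univ
    fun (j : xi.parts.ToType) _ => isPolyCount_level (n := j.1) (w := w j) (by
      have := Fintype.mem_piFinset.1 (Finset.mem_filter.1 hw).1 j
      rw [Finset.mem_range] at this
      omega)
  refine ⟨P, fun k _ _ => (hP k).trans ?_⟩
  have : Fintype (NilpModule k xi) := Fintype.ofFinite _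
  beta_reduce
  rw [Nat.card_eq_fintype_card, Fintype.card_subtype,
    Finset.card_eq_sum_card_fiberwise (f := levelVector k) (t := W)]
  · rw [Nat.cast_sum]
    refine Finset.sum_congr rfl fun w hw => ?_
    rw [← Nat.cast_prod, ← Nat.card_pi, Finset.filter_filter, ← Fintype.card_subtype,
      ← Nat.card_eq_fintype_card]
    congr 1
    refine Nat.card_congr ((Equiv.subtypePiEquivPi (p := fun (j : xi.parts.ToType)
      (y : CyclicModule k j.1) =>
        level (⊥ : Submodule k[X] (CyclicModule k j.1)) y = w j)).symm.trans
      (Equiv.subtypeEquivRight fun x => ?_))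
    constructor
    · intro h
      have h' : levelVector k x = w := funext h
      exact ⟨by rw [h']; exact (Finset.mem_filter.1 hw).2, h'⟩
    · rintro ⟨-, rfl⟩ j
      rfl
  · intro x hx
    have hx' : C (levelVector k x) := by simpa using hx
    refine Finset.mem_coe.2 (Finset.mem_filter.2 ⟨Fintype.mem_piFinset.2 fun j => ?_, hx'⟩)
    exact Finset.mem_range.2 (Nat.lt_succ_of_le (levelVector_le x j))

section denominators

theorem X_pow_sub_monic {a b : ℕ} (h : b < a) :
    (Polynomial.X ^ a - Polynomial.X ^ b : ℤ[X]).Monic := by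
  refine Polynomial.monic_X_pow_sub ?_
  rw [Polynomial.degree_X_pow]
  exact_mod_cast h

theorem eval_X_pow_sub_ne_zero {a b : ℕ} (h : b < a) (k : Type) [Field k] [Finite k] :
    (Polynomial.X ^ a - Polynomial.X ^ b : ℤ[X]).eval (Nat.card k : ℤ) ≠ 0 := by
  rw [Polynomial.eval_sub, Polynomial.eval_pow, Polynomial.eval_pow, Polynomial.eval_X, sub_ne_zero]
  exact_mod_cast (Nat.pow_lt_pow_right (one_lt_natCard k) h).ne'

end denominators

theorem isPolyCount_hallNumber_single {r : ℕ} (hr : 0 < r) (lam xi : Ptn) :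
    IsPolyCount fun k _ _ => (hallNumber k lam (Ptn.single r) xi : ℤ) := by
  refine IsPolyCount.of_mul_eval (X_pow_sub_monic (Nat.sub_lt hr one_pos))
    (eval_X_pow_sub_ne_zero (Nat.sub_lt hr one_pos)) ?_
  obtain ⟨P, hP⟩ := isPolyCount_levelVector xi fun w =>
    sInf {a | ∀ j : xi.parts.ToType, w j ≤ j.1 - (j.1 - a)} = r ∧ ∀ i,
      lam.rk i + (r - sInf {a | ∀ j : xi.parts.ToType, w j ≤ j.1 - (min i j.1 - a)}) = xi.rk i
  refine ⟨P, fun k _ _ => (hP k).trans ?_⟩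
  simp only [← level_bot_eq, ← level_powRange_eq]
  rw [← card_mul_hallNumber_single hr lam xi]
  simp [mul_comm]

/-! ### The lowest coefficient of `u_lam u_(r)` -/

section leading

variable {k : Type} [Field k] [Finite k]

-- The rank conditions say that `x` has level `i` over `T ^ i N` for `i ≤ r`, and level at least `r`
-- beyond. One test suffices: a relation `T ^ l x = T ^ i y` with `l < min i r`, multiplied by `T ^
-- (r - 1 - l)`, would put `T ^ (r - 1) x` into `T ^ r N`.
omit [Finite k] in
theorem level_cons_iff {r : ℕ} (hr : 0 < r) (lam : Ptn) {N : Type*} [AddCommGroup N] [Module k[X] N]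
    (hN : XNilpotent k N) (x : N) :
    (level (⊥ : Submodule k[X] N) x = r ∧ ∀ i,
      lam.rk i + (r - level (powRange k N i) x) = (Ptn.cons r hr lam).rk i) ↔
    (Polynomial.X ^ r : k[X]) • x = 0 ∧ (Polynomial.X ^ (r - 1) : k[X]) • x ∉ powRange k N r := by
  rw [pow_smul_eq_zero_iff hN]
  constructor
  · rintro ⟨h1, h2⟩
    refine ⟨h1.le, fun h => ?_⟩
    rw [pow_smul_mem_iff hN] at h
    have := h2 r
    rw [Ptn.rk_cons] at this
    omega
  · rintro ⟨h1, h2⟩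
    have hr' : level (⊥ : Submodule k[X] N) x = r := by
      refine le_antisymm h1 (not_lt.1 fun h => h2 ?_)
      rw [(pow_smul_eq_zero_iff hN).2 (show _ ≤ r - 1 by omega)]
      exact zero_mem _
    refine ⟨hr', fun i => ?_⟩
    have hi : level (powRange k N i) x ≤ i :=
      (pow_smul_mem_iff hN).1 (pow_smul_mem_powRange i x)
    have hge : min i r ≤ level (powRange k N i) x := by
      by_contra hlt
      push Not at hlt
      refine h2 ?_
      obtain ⟨y, hy⟩ := mem_powRange.1 ((pow_smul_mem_iff hN (V := powRange k N i) (x := x)).2 le_rfl)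
      set l := level (powRange k N i) x
      rw [show r - 1 = (r - 1 - l) + l by omega, pow_add, mul_smul, ← hy, smul_smul, ← pow_add]
      exact powRange_antitone (by omega) (pow_smul_mem_powRange _ y)
    rw [Ptn.rk_cons]
    omega

theorem card_mul_hallNumber_cons {r : ℕ} (hr : 0 < r) (lam : Ptn) :
    ((Nat.card k : ℤ) ^ r - (Nat.card k : ℤ) ^ (r - 1)) *
      hallNumber k lam (Ptn.single r) (Ptn.cons r hr lam) =
    (Nat.card k : ℤ) ^ ((Ptn.cons r hr lam).parts.map fun p => min p r).sum -
      (Nat.card k : ℤ) ^ ((Ptn.cons r hr lam).parts.map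
        fun p => min p r - if p = r then 1 else 0).sum := by
  set xi := Ptn.cons r hr lam
  have hN := xNilpotent_nilpModule k xi
  -- `A` is the kernel of `T ^ r`, and `B` consists of its elements failing the second condition of
  -- `level_cons_iff`. Only the coordinates at parts equal to `r` distinguish them, each by one
  -- dimension.
  let A : Set (NilpModule k xi) := {x | ∀ j, x j ∈ powRange k (CyclicModule k j.1) (j.1 - r)}
  let B : Set (NilpModule k xi) := {x | ∀ j, x j ∈ powRange k (CyclicModule k j.1)
    (j.1 - r + if j.1 = r then 1 else 0)}
  have hA : A.ncard = Nat.card k ^ (xi.parts.map fun p => min p r).sum := by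
    rw [← Nat.card_coe_set_eq, ← sum_toType xi.parts fun p => min p r]
    refine (card_pi_powRange k xi fun j => j.1 - r).trans ?_
    congr 1
    exact Finset.sum_congr rfl fun j _ => by omega
  have hB : B.ncard = Nat.card k ^
      (xi.parts.map fun p => min p r - if p = r then 1 else 0).sum := by
    rw [← Nat.card_coe_set_eq, ← sum_toType xi.parts fun p => min p r - if p = r then 1 else 0]
    refine (card_pi_powRange k xi fun j => j.1 - r + if j.1 = r then 1 else 0).trans ?_
    congr 1
    exact Finset.sum_congr rfl fun j _ => by split_ifs <;> omega
  have hBA : B ⊆ A := fun x hx j => powRange_antitone (Nat.le_add_right _ _) (hx j)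
  have hset : {x : NilpModule k xi | level (⊥ : Submodule k[X] (NilpModule k xi)) x = r ∧ ∀ i,
      lam.rk i + (r - level (powRange k (NilpModule k xi) i) x) = xi.rk i} = A \ B := by
    ext x
    refine (level_cons_iff hr lam hN x).trans ?_
    rw [pow_smul_nilpModule_eq_zero_iff, pow_smul_mem_powRange_nilpModule_iff, Set.mem_sdiff]
    refine and_congr_right fun hxA => not_congr (forall_congr' fun j => ?_)
    have hj := hxA j
    split_ifs with h
    · rw [show min r j.1 - (r - 1) = j.1 - r + 1 by omega]
    · rw [add_zero]
      refine iff_of_true ?_ hj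
      rcases lt_or_gt_of_ne h with h' | h'
      · rw [show min r j.1 - (r - 1) = 0 by omega]
        simp
      · exact powRange_antitone (by omega) hj
  rw [card_mul_hallNumber_single hr]
  have h1 : Nat.card {x : NilpModule k xi //
        level (⊥ : Submodule k[X] (NilpModule k xi)) x = r ∧ ∀ i,
          lam.rk i + (r - level (powRange k (NilpModule k xi) i) x) = xi.rk i} = (A \ B).ncard := by
    rw [← hset, ← Nat.card_coe_set_eq]
    rfl
  have h2 := Set.ncard_sdiff_add_ncard_of_subset hBA (Set.toFinite _)
  rw [h1, eq_sub_iff_add_eq]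
  rw [hA, hB] at h2
  exact_mod_cast h2

end leading

theorem sum_min_cons {r : ℕ} (hr : 0 < r) (lam : Ptn) :
    ((Ptn.cons r hr lam).parts.map fun p => min p r).sum =
      ((Ptn.cons r hr lam).parts.map fun p => min p r - if p = r then 1 else 0).sum +
        (lam.mult r + 1) := by
  rw [← Ptn.mult_cons r hr, Ptn.mult]
  induction (Ptn.cons r hr lam).parts using Multiset.induction_on with
  | empty => simp
  | cons a s ih =>
    rw [Multiset.map_cons, Multiset.map_cons, Multiset.sum_cons, Multiset.sum_cons,
      Multiset.count_cons, ih]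
    split_ifs <;> omega

/-! ### Existence of all Hall polynomials -/

theorem Ptn.eq_empty_or_cons (lam : Ptn) :
    lam = Ptn.empty ∨ ∃ r hr mu, (∀ p ∈ mu.parts, r ≤ p) ∧ lam = Ptn.cons r hr mu := by
  induction lam using Ptn.induction_min with
  | h0 => exact Or.inl rfl
  | h1 r hr mu hmin _ => exact Or.inr ⟨r, hr, mu, hmin, rfl⟩

theorem IsPolyCount.congr {f g : (k : Type) → [Field k] → [Finite k] → ℤ} (hf : IsPolyCount f)
    (h : ∀ (k : Type) [Field k] [Finite k], f k = g k) : IsPolyCount g := by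
  obtain ⟨P, hP⟩ := hf
  exact ⟨P, fun k _ _ => (hP k).trans (h k)⟩

theorem isPolyCount_hallNumber_empty_right (lam xi : Ptn) :
    IsPolyCount fun k _ _ => (hallNumber k lam Ptn.empty xi : ℤ) := by
  by_cases h : lam = xi
  · subst h
    exact (IsPolyCount.const 1).congr fun k _ _ => by
      rw [hallNumber_comm, hallNumber_empty_self, Nat.cast_one]
  · exact (IsPolyCount.const 0).congr fun k _ _ => by
      rw [hallNumber_comm, hallNumber_empty_ne k h, Nat.cast_zero]

/-- Associativity for `lam`, `mu`, `(r)` is solved for the term at `cons r hr mu`. The left side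
involves only the smaller `mu` and one-row types. The other nonzero terms on the right have larger
energy. -/
theorem isPolyCount_hallNumber_cons (lam xi : Ptn) {r : ℕ} (hr : 0 < r) (mu : Ptn)
    (hsize : ∀ nu rho, IsPolyCount fun k _ _ => (hallNumber k nu mu rho : ℤ))
    (henergy : ∀ nu : Ptn, nu.size = (Ptn.cons r hr mu).size →
      (Ptn.cons r hr mu).energy < nu.energy →
      IsPolyCount fun k _ _ => (hallNumber k lam nu xi : ℤ)) :
    IsPolyCount fun k _ _ => (hallNumber k lam (Ptn.cons r hr mu) xi : ℤ) := by
  classical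
  set mu' := Ptn.cons r hr mu with hmu'
  have hmem : mu' ∈ Ptn.ofSize (mu.size + (Ptn.single r).size) := by
    rw [Ptn.mem_ofSize, hmu', Ptn.size_cons, Ptn.size_single, add_comm]
  have hleft : IsPolyCount fun k _ _ => ∑ nu ∈ Ptn.ofSize (lam.size + mu.size),
      (hallNumber k lam mu nu : ℤ) * (hallNumber k nu (Ptn.single r) xi : ℤ) :=
    IsPolyCount.sum _ fun nu _ => (hsize lam nu).mul (isPolyCount_hallNumber_single hr nu xi)
  have hright : IsPolyCount fun k _ _ =>
      ∑ nu ∈ (Ptn.ofSize (mu.size + (Ptn.single r).size)).erase mu',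
      (hallNumber k lam nu xi : ℤ) * (hallNumber k mu (Ptn.single r) nu : ℤ) := by
    refine IsPolyCount.sum _ fun nu hnu => ?_
    have hs : mu'.size = nu.size := by
      rw [Ptn.mem_ofSize.1 hmem, Ptn.mem_ofSize.1 (Finset.mem_of_mem_erase hnu)]
    by_cases h : ∀ i, mu'.rk i ≤ nu.rk i
    · exact (henergy nu hs.symm (Ptn.energy_lt hs h (Finset.ne_of_mem_erase hnu).symm)).mul
        (isPolyCount_hallNumber_single hr mu nu)
    · refine (IsPolyCount.const 0).congr fun k _ _ => ?_
      have : hallNumber k mu (Ptn.single r) nu = 0 := by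
        by_contra h0
        refine h fun i => ?_
        have := rk_add_le_of_hallNumber_ne_zero h0 i
        rw [Ptn.rk_single hr] at this
        rw [hmu', Ptn.rk_cons]
        omega
      rw [this, Nat.cast_zero, mul_zero]
  set A := (mu'.parts.map fun p => min p r).sum with hA
  set B := (mu'.parts.map fun p => min p r - if p = r then 1 else 0).sum with hB
  have hBA : B < A := by
    have : A = B + (mu.mult r + 1) := sum_min_cons hr mu
    omega
  refine IsPolyCount.of_mul_eval (X_pow_sub_monic hBA) (eval_X_pow_sub_ne_zero hBA) ?_
  refine (((IsPolyCount.card_pow r).sub (IsPolyCount.card_pow (r - 1))).mul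
    (hleft.sub hright)).congr fun k _ _ => ?_
  have h1 := card_mul_hallNumber_cons (k := k) hr mu
  have h2 := hallNumber_assoc k lam mu (Ptn.single r) xi
  rw [← Finset.add_sum_erase _ _ hmem] at h2
  have h3 : (∑ nu ∈ Ptn.ofSize (lam.size + mu.size),
      (hallNumber k lam mu nu : ℤ) * (hallNumber k nu (Ptn.single r) xi : ℤ)) =
      hallNumber k lam mu' xi * hallNumber k mu (Ptn.single r) mu' +
      ∑ nu ∈ (Ptn.ofSize (mu.size + (Ptn.single r).size)).erase mu',
      (hallNumber k lam nu xi : ℤ) * (hallNumber k mu (Ptn.single r) nu : ℤ) := by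
    exact_mod_cast h2
  rw [h3, Polynomial.eval_sub, Polynomial.eval_pow, Polynomial.eval_pow, Polynomial.eval_X, ← h1]
  ring

theorem isPolyCount_hallNumber (lam mu xi : Ptn) :
    IsPolyCount fun k _ _ => (hallNumber k lam mu xi : ℤ) := by
  induction hn : mu.size using Nat.strong_induction_on generalizing lam mu xi with
  | _ n ih =>
    -- For fixed size the induction runs downwards on the energy, which is at most `n * n`.
    induction he : n * n - mu.energy using Nat.strong_induction_on generalizing mu with
    | _ e ihe =>
      rcases mu.eq_empty_or_cons with rfl | ⟨r, hr, mu, -, rfl⟩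
      · exact isPolyCount_hallNumber_empty_right lam xi
      · refine isPolyCount_hallNumber_cons lam xi hr mu (fun nu rho => ?_) (fun nu hs hlt => ?_)
        · refine ih mu.size ?_ nu mu rho rfl
          rw [← hn, Ptn.size_cons]
          omega
        · have := nu.energy_le
          rw [hs, hn] at this
          exact ihe (n * n - nu.energy) (by omega) nu (hs.trans hn) rfl

/-! ### Identities of Hall polynomials, from their values at finite fields -/

theorem isHallPolynomial_hallPolynomial (lam mu xi : Ptn) :
    IsHallPolynomial lam mu xi (hallPolynomial lam mu xi) := by
  have h : ∃ P : ℤ[X], IsHallPolynomial lam mu xi P := isPolyCount_hallNumber lam mu xi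
  rw [hallPolynomial, dif_pos h]
  exact h.choose_spec

theorem hallPolynomial_eval (lam mu xi : Ptn) (k : Type) [Field k] [Finite k] :
    (hallPolynomial lam mu xi).eval (Nat.card k : ℤ) = hallNumber k lam mu xi :=
  isHallPolynomial_hallPolynomial lam mu xi k

theorem hallPolynomial_comm (lam mu xi : Ptn) :
    hallPolynomial lam mu xi = hallPolynomial mu lam xi :=
  polynomial_ext_of_eval_card fun k _ _ => by
    rw [hallPolynomial_eval, hallPolynomial_eval, hallNumber_comm]

theorem hallPolynomial_empty_self (mu : Ptn) : hallPolynomial Ptn.empty mu mu = 1 :=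
  polynomial_ext_of_eval_card fun k _ _ => by
    rw [hallPolynomial_eval, hallNumber_empty_self, Polynomial.eval_one, Nat.cast_one]

theorem hallPolynomial_eq_zero {lam mu xi : Ptn}
    (h : ∀ (k : Type) [Field k] [Finite k], hallNumber k lam mu xi = 0) :
    hallPolynomial lam mu xi = 0 :=
  polynomial_ext_of_eval_card fun k _ _ => by
    rw [hallPolynomial_eval, h, Polynomial.eval_zero, Nat.cast_zero]

theorem hallPolynomial_empty_ne {mu xi : Ptn} (h : mu ≠ xi) :
    hallPolynomial Ptn.empty mu xi = 0 :=
  hallPolynomial_eq_zero fun k _ _ => hallNumber_empty_ne k h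

theorem rk_add_le_of_hallPolynomial_ne_zero {lam mu xi : Ptn} (h : hallPolynomial lam mu xi ≠ 0)
    (i : ℕ) : lam.rk i + mu.rk i ≤ xi.rk i := by
  by_contra hlt
  exact h (hallPolynomial_eq_zero fun k _ _ => by
    by_contra h0
    exact hlt (rk_add_le_of_hallNumber_ne_zero h0 i))

theorem size_add_of_hallPolynomial_ne_zero {lam mu xi : Ptn} (h : hallPolynomial lam mu xi ≠ 0) :
    lam.size + mu.size = xi.size := by
  by_contra hne
  exact h (hallPolynomial_eq_zero fun k _ _ => by
    by_contra h0
    exact hne (size_add_of_hallNumber_ne_zero h0))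

theorem hallPolynomial_assoc (lam mu rho xi : Ptn) :
    ∑ nu ∈ Ptn.ofSize (lam.size + mu.size), hallPolynomial lam mu nu * hallPolynomial nu rho xi =
      ∑ nu ∈ Ptn.ofSize (mu.size + rho.size), hallPolynomial lam nu xi * hallPolynomial mu rho nu :=
  polynomial_ext_of_eval_card fun k _ _ => by
    simp only [Polynomial.eval_finsetSum, Polynomial.eval_mul, hallPolynomial_eval]
    exact_mod_cast hallNumber_assoc k lam mu rho xi

theorem mul_hallPolynomial_cons {r : ℕ} (hr : 0 < r) (lam : Ptn) :
    (Polynomial.X ^ r - Polynomial.X ^ (r - 1)) *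
      hallPolynomial lam (Ptn.single r) (Ptn.cons r hr lam) =
    Polynomial.X ^ ((Ptn.cons r hr lam).parts.map fun p => min p r).sum -
      Polynomial.X ^ ((Ptn.cons r hr lam).parts.map
        fun p => min p r - if p = r then 1 else 0).sum :=
  polynomial_ext_of_eval_card fun k _ _ => by
    simp only [Polynomial.eval_sub, Polynomial.eval_mul, Polynomial.eval_pow, Polynomial.eval_X,
      hallPolynomial_eval]
    exact card_mul_hallNumber_cons hr lam

/-! ### The ring axioms -/

namespace HallAlg

/-- The structure constants of the Hall multiplication. -/
noncomputable def structConst (lam mu xi : Ptn) : RatFunc ℚ :=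
  Polynomial.aeval qGen (hallPolynomial lam mu xi)

theorem hallPolynomial_ne_zero {lam mu xi : Ptn} (h : structConst lam mu xi ≠ 0) :
    hallPolynomial lam mu xi ≠ 0 := fun h0 => h (by rw [structConst, h0, map_zero])

theorem mul_def (a b : HallAlg) : a * b = hallMul a b := rfl

theorem one_def : (1 : HallAlg) = u Ptn.empty := rfl

theorem u_mul_u (lam mu : Ptn) :
    u lam * u mu = ∑ xi ∈ Ptn.ofSize (lam.size + mu.size), structConst lam mu xi • u xi := by
  rw [mul_def, hallMul, Module.Basis.constr_basis, Module.Basis.constr_basis, Ptn.sum_ofSize]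
  rfl

theorem induction_u {P : HallAlg → Prop} (hu : ∀ lam, P (u lam)) (hadd : ∀ a b, P a → P b → P (a + b))
    (hsmul : ∀ (c : RatFunc ℚ) a, P a → P (c • a)) (a : HallAlg) : P a := by
  have h0 : P 0 := by simpa using hsmul 0 (u Ptn.empty) (hu _)
  have ha : a ∈ Submodule.span (RatFunc ℚ) (Set.range u) := by
    rw [u.span_eq]
    trivial
  induction ha using Submodule.span_induction with
  | mem x hx =>
    obtain ⟨lam, rfl⟩ := hx
    exact hu lam
  | zero => exact h0
  | add x y _ _ hx hy => exact hadd x y hx hy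
  | smul c x _ hx => exact hsmul c x hx

theorem hall_one_mul (a : HallAlg) : 1 * a = a := by
  induction a using induction_u with
  | hu mu =>
    rw [one_def, u_mul_u, Finset.sum_eq_single mu]
    · rw [structConst, hallPolynomial_empty_self, map_one, one_smul]
    · intro xi _ hne
      rw [structConst, hallPolynomial_empty_ne hne.symm, map_zero, zero_smul]
    · intro h
      exact absurd (Ptn.mem_ofSize.2 (by rw [Ptn.size_empty, zero_add])) h
  | hadd a b ha hb =>
    rw [mul_def] at *
    rw [map_add, ha, hb]
  | hsmul c a ha =>
    rw [mul_def] at *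
    rw [map_smul, ha]

theorem hall_mul_comm (a b : HallAlg) : a * b = b * a := by
  induction a using induction_u generalizing b with
  | hu lam =>
    induction b using induction_u with
    | hu mu =>
      rw [u_mul_u, u_mul_u, add_comm]
      exact Finset.sum_congr rfl fun xi _ => by rw [structConst, hallPolynomial_comm, structConst]
    | hadd a b ha hb =>
      simp only [mul_def] at *
      rw [map_add, map_add, LinearMap.add_apply, ha, hb]
    | hsmul c a ha =>
      simp only [mul_def] at *
      rw [map_smul, map_smul, LinearMap.smul_apply, ha]
  | hadd a a' ha hb =>
    simp only [mul_def] at *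
    rw [map_add, map_add, LinearMap.add_apply, ha, hb]
  | hsmul c a ha =>
    simp only [mul_def] at *
    rw [map_smul, map_smul, LinearMap.smul_apply, ha]

theorem sum_structConst_assoc (lam mu rho xi : Ptn) :
    ∑ nu ∈ Ptn.ofSize (lam.size + mu.size), structConst lam mu nu * structConst nu rho xi =
      ∑ nu ∈ Ptn.ofSize (mu.size + rho.size), structConst lam nu xi * structConst mu rho nu := by
  simp only [structConst, ← map_mul, ← map_sum, hallPolynomial_assoc]

theorem u_mul_assoc (lam mu rho : Ptn) : u lam * u mu * u rho = u lam * (u mu * u rho) := by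
  have h1 : u lam * u mu * u rho = ∑ xi ∈ Ptn.ofSize (lam.size + mu.size + rho.size),
      (∑ nu ∈ Ptn.ofSize (lam.size + mu.size), structConst lam mu nu * structConst nu rho xi) •
        u xi := by
    rw [u_mul_u, mul_def, map_sum, LinearMap.sum_apply]
    simp only [Finset.sum_smul]
    rw [Finset.sum_comm]
    refine Finset.sum_congr rfl fun nu hnu => ?_
    rw [map_smul, LinearMap.smul_apply, ← mul_def, u_mul_u, Ptn.mem_ofSize.1 hnu, Finset.smul_sum]
    exact Finset.sum_congr rfl fun xi _ => smul_smul _ _ _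
  have h2 : u lam * (u mu * u rho) = ∑ xi ∈ Ptn.ofSize (lam.size + mu.size + rho.size),
      (∑ nu ∈ Ptn.ofSize (mu.size + rho.size), structConst lam nu xi * structConst mu rho nu) •
        u xi := by
    rw [u_mul_u mu, mul_def, map_sum]
    simp only [Finset.sum_smul]
    rw [Finset.sum_comm]
    refine Finset.sum_congr rfl fun nu hnu => ?_
    rw [map_smul, ← mul_def, u_mul_u, Ptn.mem_ofSize.1 hnu, Finset.smul_sum, add_assoc]
    exact Finset.sum_congr rfl fun xi _ => by rw [smul_smul, mul_comm]
  rw [h1, h2]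
  exact Finset.sum_congr rfl fun xi _ => by rw [sum_structConst_assoc]

theorem hall_mul_assoc (a b c : HallAlg) : a * b * c = a * (b * c) := by
  induction a using induction_u generalizing b c with
  | hu lam =>
    induction b using induction_u generalizing c with
    | hu mu =>
      induction c using induction_u with
      | hu rho => exact u_mul_assoc lam mu rho
      | hadd a b ha hb =>
        simp only [mul_def] at *
        simp only [map_add, ha, hb]
      | hsmul c a ha =>
        simp only [mul_def] at *
        simp only [map_smul, ha]
    | hadd a b ha hb =>
      simp only [mul_def] at *
      simp only [map_add, LinearMap.add_apply, ha, hb]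
    | hsmul c a ha =>
      simp only [mul_def] at *
      simp only [map_smul, LinearMap.smul_apply, ha]
  | hadd a b ha hb =>
    simp only [mul_def] at *
    simp only [map_add, LinearMap.add_apply, ha, hb]
  | hsmul c a ha =>
    simp only [mul_def] at *
    simp only [map_smul, LinearMap.smul_apply, ha]

noncomputable instance : CommRing HallAlg := commRing hall_one_mul hall_mul_comm hall_mul_assoc

noncomputable instance : Algebra (RatFunc ℚ) HallAlg :=
  algebra hall_one_mul hall_mul_comm hall_mul_assoc

/-! ### Triangularity of the monomials `x_lam` -/

/-- The product `x_lam` of the `x_r` over the parts `r` of `lam`. -/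
noncomputable def xProd (lam : Ptn) : HallAlg := (lam.parts.map x).prod

theorem xProd_empty : xProd Ptn.empty = u Ptn.empty := by
  rw [xProd, Ptn.parts_empty, Multiset.map_zero, Multiset.prod_zero]
  rfl

theorem repr_u_mul_u (lam mu xi : Ptn) :
    u.repr (u lam * u mu) xi = structConst lam mu xi := by
  classical
  rw [u_mul_u, map_sum, Finsupp.finsetSum_apply]
  simp only [map_smul, Module.Basis.repr_self, Finsupp.smul_apply, smul_eq_mul,
    Finsupp.single_apply, mul_ite, mul_one, mul_zero]
  rw [Finset.sum_ite_eq' ]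
  split_ifs with h
  · rfl
  · by_contra h0
    exact h (Ptn.mem_ofSize.2
      (size_add_of_hallPolynomial_ne_zero (hallPolynomial_ne_zero (Ne.symm h0))).symm)

theorem repr_mul_u (a : HallAlg) (mu xi : Ptn) :
    u.repr (a * u mu) xi = ∑ nu ∈ (u.repr a).support, u.repr a nu * structConst nu mu xi := by
  have ha : a = ∑ nu ∈ (u.repr a).support, u.repr a nu • u nu := (u.linearCombination_repr a).symm
  conv_lhs => rw [ha, mul_def, map_sum, LinearMap.sum_apply, map_sum, Finsupp.finsetSum_apply]
  refine Finset.sum_congr rfl fun nu _ => ?_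
  rw [map_smul, LinearMap.smul_apply, map_smul, Finsupp.smul_apply, ← mul_def, repr_u_mul_u,
    smul_eq_mul]

theorem xProd_cons (r : ℕ) (hr : 0 < r) (lam : Ptn) :
    xProd (Ptn.cons r hr lam) = (1 - qGen⁻¹) • (xProd lam * u (Ptn.single r)) := by
  rw [xProd, Ptn.parts_cons, Multiset.map_cons, Multiset.prod_cons, mul_comm, ← xProd, x]
  exact map_smul (hallMul (xProd lam)) _ _

theorem repr_xProd_cons (r : ℕ) (hr : 0 < r) (lam xi : Ptn) :
    u.repr (xProd (Ptn.cons r hr lam)) xi = (1 - qGen⁻¹) *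
      ∑ nu ∈ (u.repr (xProd lam)).support,
        u.repr (xProd lam) nu * structConst nu (Ptn.single r) xi := by
  rw [xProd_cons, map_smul, Finsupp.smul_apply, smul_eq_mul, repr_mul_u]

/-- Each factor `u_(r)` raises the rank at `i` by at least `r - i`, which is exactly what the part
`r` contributes to `lam.rk i`. -/
theorem size_eq_and_rk_le_of_repr_xProd_ne_zero {lam mu : Ptn} (h : u.repr (xProd lam) mu ≠ 0) :
    lam.size = mu.size ∧ ∀ i, lam.rk i ≤ mu.rk i := by
  induction lam using Ptn.induction_min generalizing mu with
  | h0 =>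
    rw [xProd_empty, Module.Basis.repr_self] at h
    obtain rfl : Ptn.empty = mu := by
      by_contra hne
      exact h (Finsupp.single_eq_of_ne (Ne.symm hne))
    exact ⟨rfl, fun i => le_rfl⟩
  | h1 r hr lam _ ih =>
    rw [repr_xProd_cons] at h
    obtain ⟨nu, _, hnu⟩ := Finset.exists_ne_zero_of_sum_ne_zero (right_ne_zero_of_mul h)
    obtain ⟨h1, h2⟩ := ih (left_ne_zero_of_mul hnu)
    have hP := hallPolynomial_ne_zero (right_ne_zero_of_mul hnu)
    have h3 := size_add_of_hallPolynomial_ne_zero hP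
    rw [Ptn.size_single] at h3
    refine ⟨by rw [Ptn.size_cons]; omega, fun i => ?_⟩
    have h4 := rk_add_le_of_hallPolynomial_ne_zero hP i
    have h5 := h2 i
    rw [Ptn.rk_single hr] at h4
    rw [Ptn.rk_cons]
    omega

theorem qGen_ne_zero : qGen ≠ 0 := pow_ne_zero _ RatFunc.X_ne_zero

theorem qGen_pow_ne_one {n : ℕ} (hn : 0 < n) : qGen ^ n ≠ 1 := by
  intro h
  rw [qGen, vGen, ← pow_mul, ← RatFunc.algebraMap_X, ← map_pow,
    ← map_one (algebraMap ℚ[X] (RatFunc ℚ))] at h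
  have h' := congrArg Polynomial.natDegree (RatFunc.algebraMap_injective ℚ h)
  rw [Polynomial.natDegree_X_pow, Polynomial.natDegree_one] at h'
  omega

theorem one_sub_qGen_inv_pow_ne_zero {n : ℕ} (hn : 0 < n) : 1 - qGen⁻¹ ^ n ≠ 0 := by
  rw [sub_ne_zero, inv_pow, ne_comm, ne_eq, inv_eq_one]
  exact qGen_pow_ne_one hn

theorem bProd_qGen_inv_ne_zero (lam : Ptn) : bProd lam qGen⁻¹ ≠ 0 :=
  Finset.prod_ne_zero_iff.2 fun _ _ => Finset.prod_ne_zero_iff.2 fun _ _ =>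
    one_sub_qGen_inv_pow_ne_zero (Nat.succ_pos _)

/-- As `r` is minimal, every `min p r` is `r`, so the larger exponent is `r` times the number of
parts of `cons r hr lam`. The smaller one differs by the multiplicity of `r`, and cancelling `q ^ r`
leaves the factor that `nStat` and `bProd` acquire. -/
theorem structConst_cons {r : ℕ} (hr : 0 < r) {lam : Ptn} (hmin : ∀ p ∈ lam.parts, r ≤ p) :
    (1 - qGen⁻¹) * structConst lam (Ptn.single r) (Ptn.cons r hr lam) =
      qGen ^ (Multiset.card lam.parts * r) * (1 - qGen⁻¹ ^ (lam.mult r + 1)) := by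
  have h := congrArg (Polynomial.aeval qGen) (mul_hallPolynomial_cons hr lam)
  have hA : ((Ptn.cons r hr lam).parts.map fun p => min p r).sum =
      r + Multiset.card lam.parts * r := by
    rw [Ptn.parts_cons, Multiset.map_cons, Multiset.sum_cons, min_self,
      Multiset.map_congr rfl fun p hp => min_eq_right (hmin p hp), Multiset.map_const',
      Multiset.sum_replicate, smul_eq_mul]
  have hB := sum_min_cons hr lam
  simp only [map_mul, map_sub, map_pow, Polynomial.aeval_X] at h
  rw [← structConst, hB] at h
  rw [hA] at hB
  set B := ((Ptn.cons r hr lam).parts.map fun p => min p r - if p = r then 1 else 0).sum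
  have hq := qGen_ne_zero
  have h1 : qGen ^ r * (1 - qGen⁻¹) = qGen ^ r - qGen ^ (r - 1) := by
    obtain ⟨s, rfl⟩ := Nat.exists_eq_add_of_lt hr
    rw [zero_add, Nat.add_sub_cancel, pow_succ]
    field_simp
  apply mul_left_cancel₀ (pow_ne_zero r hq)
  rw [← mul_assoc, h1, h, ← mul_assoc, ← pow_add, hB, pow_add, inv_pow]
  have hm := pow_ne_zero (lam.mult r + 1) hq
  field_simp

theorem repr_xProd_self (lam : Ptn) :
    u.repr (xProd lam) lam = qGen ^ lam.nStat * bProd lam qGen⁻¹ := by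
  induction lam using Ptn.induction_min with
  | h0 => simp [xProd_empty]
  | h1 r hr lam hmin ih =>
    rw [repr_xProd_cons, Finset.sum_eq_single lam]
    · rw [ih, mul_left_comm, structConst_cons hr hmin, Ptn.nStat_cons hr hmin, bProd_cons, pow_add]
      ring
    -- Triangularity gives `lam.rk i ≤ nu.rk i`, and the rank inequality for the product gives the
    -- reverse, so only `nu = lam` contributes.
    · intro nu hnu hne
      by_contra h0
      refine hne (Ptn.rk_injective fun i => ?_)
      have h1 := rk_add_le_of_hallPolynomial_ne_zero
        (hallPolynomial_ne_zero (right_ne_zero_of_mul h0)) i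
      have h2 := (size_eq_and_rk_le_of_repr_xProd_ne_zero (Finsupp.mem_support_iff.1 hnu)).2 i
      rw [Ptn.rk_cons, Ptn.rk_single hr] at h1
      omega
    · intro h
      rw [Finsupp.notMem_support_iff.1 h, zero_mul]

theorem repr_xProd_self_ne_zero (lam : Ptn) : u.repr (xProd lam) lam ≠ 0 := by
  rw [repr_xProd_self]
  exact mul_ne_zero (pow_ne_zero _ qGen_ne_zero) (bProd_qGen_inv_ne_zero lam)

theorem energy_lt_of_repr_xProd_ne_zero {lam mu : Ptn} (h : u.repr (xProd lam) mu ≠ 0)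
    (hne : lam ≠ mu) : lam.energy < mu.energy :=
  Ptn.energy_lt (size_eq_and_rk_le_of_repr_xProd_ne_zero h).1
    (size_eq_and_rk_le_of_repr_xProd_ne_zero h).2 hne

theorem xProd_eq_sum (lam : Ptn) : xProd lam = u.repr (xProd lam) lam • u lam +
    ∑ mu ∈ (u.repr (xProd lam)).support.erase lam, u.repr (xProd lam) mu • u mu := by
  rw [Finset.add_sum_erase _ (fun mu => u.repr (xProd lam) mu • u mu)
    (Finsupp.mem_support_iff.2 (repr_xProd_self_ne_zero lam))]
  exact (u.linearCombination_repr _).symm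

theorem exists_xProd_eq (n : ℕ) (lam : n.Partition) : ∃ γ : n.Partition → RatFunc ℚ,
    xProd ⟨n, lam⟩ = (qGen ^ Ptn.nStat ⟨n, lam⟩ * bProd ⟨n, lam⟩ qGen⁻¹) • u ⟨n, lam⟩ +
      ∑ mu ∈ strictlyAbove lam, γ mu • u ⟨n, mu⟩ := by
  classical
  refine ⟨fun mu => u.repr (xProd ⟨n, lam⟩) ⟨n, mu⟩, ?_⟩
  have hinj : Function.Injective (fun mu : n.Partition => (⟨n, mu⟩ : Ptn)) := sigma_mk_injective
  conv_lhs => rw [xProd_eq_sum, repr_xProd_self]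
  congr 1
  rw [← Finset.sum_image (f := fun mu : Ptn => u.repr (xProd ⟨n, lam⟩) mu • u mu)
    (g := fun mu : n.Partition => (⟨n, mu⟩ : Ptn)) fun _ _ _ _ h => hinj h]
  -- The support may be smaller than the set of dominating partitions; the additional coefficients
  -- are zero.
  refine Finset.sum_subset (fun mu hmu => ?_) fun mu hmu hnot => ?_
  · obtain ⟨hne, hmem⟩ := Finset.mem_erase.1 hmu
    obtain ⟨h1, h2⟩ := size_eq_and_rk_le_of_repr_xProd_ne_zero (Finsupp.mem_support_iff.1 hmem)
    obtain ⟨m, mu⟩ := mu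
    obtain rfl : n = m := h1
    refine Finset.mem_image.2 ⟨mu, Finset.mem_filter.2 ⟨Finset.mem_univ _, ?_, ?_⟩, rfl⟩
    · exact Ptn.sum_row_le_of_rk_le h2
    · rintro rfl
      exact hne rfl
  · obtain ⟨nu, hnu, rfl⟩ := Finset.mem_image.1 hmu
    have hne : (⟨n, nu⟩ : Ptn) ≠ ⟨n, lam⟩ := fun h =>
      (Finset.mem_filter.1 hnu).2.2 (hinj h).symm
    rw [Finset.mem_erase, not_and] at hnot
    rw [Finsupp.notMem_support_iff.1 (hnot hne), zero_smul]

/-! ### The basis of monomials -/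

theorem linearIndependent_xProd : LinearIndependent (RatFunc ℚ) xProd := by
  rw [linearIndependent_iff]
  intro l hl
  by_contra hne
  -- In a relation, take a partition of least energy: no other monomial of the relation involves its
  -- basis vector.
  obtain ⟨lam, hlam, hmin⟩ := l.support.exists_min_image Ptn.energy
    (Finsupp.support_nonempty_iff.2 hne)
  have h : u.repr (Finsupp.linearCombination (RatFunc ℚ) xProd l) lam = 0 := by
    rw [hl, map_zero, Finsupp.zero_apply]
  rw [Finsupp.linearCombination_apply, Finsupp.sum, map_sum, Finsupp.finsetSum_apply,
    Finset.sum_eq_single lam] at h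
  · rw [map_smul, Finsupp.smul_apply, smul_eq_mul] at h
    exact mul_ne_zero (Finsupp.mem_support_iff.1 hlam) (repr_xProd_self_ne_zero lam) h
  · intro mu hmu hne'
    rw [map_smul, Finsupp.smul_apply, smul_eq_mul]
    by_contra h0
    exact (energy_lt_of_repr_xProd_ne_zero (right_ne_zero_of_mul h0) hne').not_ge (hmin mu hmu)
  · intro hnot
    exact absurd hlam hnot

/-- Solving the triangular expansion for `u lam` leaves only partitions of the same size and larger
energy, and the energy is bounded. -/
theorem u_mem_span_xProd (lam : Ptn) :
    u lam ∈ Submodule.span (RatFunc ℚ) (Set.range xProd) := by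
  induction he : lam.size * lam.size - lam.energy using Nat.strong_induction_on generalizing lam with
  | _ e ih =>
    have h : u lam = (u.repr (xProd lam) lam)⁻¹ • (xProd lam -
        ∑ mu ∈ (u.repr (xProd lam)).support.erase lam, u.repr (xProd lam) mu • u mu) := by
      rw [eq_inv_smul_iff₀ (repr_xProd_self_ne_zero lam), eq_sub_iff_add_eq]
      exact (xProd_eq_sum lam).symm
    rw [h]
    refine Submodule.smul_mem _ _ (Submodule.sub_mem _ (Submodule.subset_span ⟨lam, rfl⟩)
      (Submodule.sum_mem _ fun mu hmu => Submodule.smul_mem _ _ (ih _ ?_ mu rfl)))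
    obtain ⟨hne, hmem⟩ := Finset.mem_erase.1 hmu
    have h0 := Finsupp.mem_support_iff.1 hmem
    have h1 := energy_lt_of_repr_xProd_ne_zero h0 hne.symm
    have h2 := (size_eq_and_rk_le_of_repr_xProd_ne_zero h0).1
    have h3 := mu.energy_le
    rw [← h2] at h3 ⊢
    omega

theorem span_xProd : Submodule.span (RatFunc ℚ) (Set.range xProd) = ⊤ := by
  rw [eq_top_iff, ← u.span_eq, Submodule.span_le]
  rintro _ ⟨lam, rfl⟩
  exact u_mem_span_xProd lam

/-! ### Algebraic independence and generation -/

/-- The partition in which `r` has multiplicity `s r`. -/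
noncomputable def ptnOfFinsupp (s : ℕ+ →₀ ℕ) : Ptn :=
  Ptn.ofParts ((Finsupp.toMultiset s).map fun r : ℕ+ => (r : ℕ)) fun p hp => by
    obtain ⟨r, -, rfl⟩ := Multiset.mem_map.1 hp
    exact r.pos

theorem ptnOfFinsupp_injective : Function.Injective ptnOfFinsupp := by
  intro s t h
  have h' := congrArg Ptn.parts h
  exact Multiset.toFinsupp.symm.injective (Multiset.map_injective PNat.coe_injective h')

theorem xProd_ptnOfFinsupp (s : ℕ+ →₀ ℕ) :
    xProd (ptnOfFinsupp s) = ∏ r ∈ s.support, x r ^ s r := by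
  rw [xProd, ptnOfFinsupp, Ptn.parts_ofParts, Multiset.map_map, Finset.prod_multiset_map_count,
    Finsupp.toFinset_toMultiset]
  simp only [Finsupp.count_toMultiset, Function.comp_apply]

/-- Distinct exponent vectors give distinct partitions, so the monomials in the `x_r` form a
subfamily of the linearly independent `xProd`. -/
theorem algebraicIndependent_x : AlgebraicIndependent (RatFunc ℚ) (fun r : ℕ+ => x r) := by
  rw [algebraicIndependent_iff]
  intro p hp
  have hli := linearIndependent_xProd.comp _ ptnOfFinsupp_injective
  rw [linearIndependent_iff'] at hli
  rw [MvPolynomial.aeval_def, MvPolynomial.eval₂_eq] at hp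
  have := hli p.support (fun d => p.coeff d) (by
    rw [← hp]
    exact Finset.sum_congr rfl fun d _ => by
      rw [Function.comp_apply, xProd_ptnOfFinsupp, Algebra.smul_def])
  ext d
  by_cases hd : d ∈ p.support
  · rw [this d hd, MvPolynomial.coeff_zero]
  · rw [MvPolynomial.notMem_support_iff.1 hd, MvPolynomial.coeff_zero]

theorem adjoin_x : Algebra.adjoin (RatFunc ℚ) (Set.range fun r : ℕ+ => x r) = ⊤ := by
  rw [eq_top_iff, ← Subalgebra.toSubmodule.le_iff_le, Algebra.top_toSubmodule, ← span_xProd,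
    Submodule.span_le]
  rintro _ ⟨lam, rfl⟩
  refine Subalgebra.multiset_prod_mem _ fun y hy => ?_
  obtain ⟨r, hr, rfl⟩ := Multiset.mem_map.1 hy
  exact Algebra.subset_adjoin ⟨⟨r, Ptn.pos_of_mem hr⟩, rfl⟩

end HallAlg

theorem mainTheorem6 :
    (∀ lam mu xi : Ptn, IsHallPolynomial lam mu xi (hallPolynomial lam mu xi)) ∧
    ∃ (hone : ∀ a : HallAlg, 1 * a = a)
      (hcomm : ∀ a b : HallAlg, a * b = b * a)
      (hassoc : ∀ a b c : HallAlg, a * b * c = a * (b * c)),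
      letI : CommRing HallAlg := HallAlg.commRing hone hcomm hassoc
      letI : Algebra (RatFunc ℚ) HallAlg := HallAlg.algebra hone hcomm hassoc
      (∀ (n : ℕ) (lam : n.Partition), ∃ γ : n.Partition → RatFunc ℚ,
        (lam.parts.map HallAlg.x).prod =
          (qGen ^ Ptn.nStat ⟨n, lam⟩ * bProd ⟨n, lam⟩ qGen⁻¹) • HallAlg.u ⟨n, lam⟩ +
            ∑ mu ∈ strictlyAbove lam, γ mu • HallAlg.u ⟨n, mu⟩) ∧
      (∃ B : Module.Basis Ptn (RatFunc ℚ) HallAlg,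
        ∀ lam : Ptn, B lam = (lam.parts.map HallAlg.x).prod) ∧
      AlgebraicIndependent (RatFunc ℚ) (fun r : ℕ+ => HallAlg.x r) ∧
      Algebra.adjoin (RatFunc ℚ) (Set.range fun r : ℕ+ => HallAlg.x r) = ⊤ := by
  refine ⟨isHallPolynomial_hallPolynomial, HallAlg.hall_one_mul, HallAlg.hall_mul_comm,
    HallAlg.hall_mul_assoc, HallAlg.exists_xProd_eq,
    ⟨Module.Basis.mk HallAlg.linearIndependent_xProd HallAlg.span_xProd.ge, fun lam => ?_⟩,
    HallAlg.algebraicIndependent_x, HallAlg.adjoin_x⟩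
  exact Module.Basis.mk_apply _ _ lam
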